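/- Let $n\ge 1$ and let $\mathbb H^n=\mathbb R^n\times\mathbb R^n\times\mathbb R$ be the Heisenberg group with group law $(x,y,\tau)\circ(x',y',\tau')=(x+x',\,y+y',\,\tau+\tau'+\tfrac12(x\cdot y'-x'\cdot y))$, with Lebesgue (Haar) measure, and with sub-Laplacian $\mathcal L=\sum_{j=1}^n(X_j^2+Y_j^2)$, where $X_j=\partial_{x_j}-\frac{y_j}{2}\partial_\tau$ and $Y_j=\partial_{y_j}+\frac{x_j}{2}\partial_\tau$. For $s\in\mathbb R$ let $$H^s_{\mathcal L}=\{f\in\mathcal D'(\mathbb H^n):(I-\mathcal L)^{s/2}f\in L^2(\mathbb H^n)\},\qquad \|f\|_{H^s_{\mathcal L}}=\|(I-\mathcal L)^{s/2}f\|_{L^2(\mathbb H^n)},$$ where $f$ and $\mathcal D'(\mathbb H^n)$ are complex-valued and $-\mathcal L$ is the nonnegative self-adjoint operator on $L^2(\mathbb H^n)$ of the closed quadratic form $\sum_j(\|X_jv\|^2+\|Y_jv\|^2)$. Let $b,m>0$. A solution of the Cauchy problem $$\partial_t^2u-\mathcal Lu+b\,\partial_tu+m\,u=0\quad(t>0),\qquad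 u(0)=u_0,\quad \partial_tu(0)=u_1 \tag{1}$$ is a function $u\in C([0,\infty);H^r_{\mathcal L})\cap C^1([0,\infty);H^{r-1}_{\mathcal L})$, for some $r\in\mathbb R$ (not tied to the data), which takes the initial values and satisfies the equation in the sense of distributions. Then there is $\delta>0$, depending only on $n,b,m$, such that for every $s\in\mathbb R$ the following holds. 1. There is $C>0$, depending only on $n,b,m,s$, such that for all $u_0\in H^s_{\mathcal L}$, $u_1\in H^{s-1}_{\mathcal L}$ and every solution $u$ of (1), one has $u(t)\in H^s_{\mathcal L}$ and $$\|u(t)\|_{H^s_{\mathcal L}}^2\le C e^{-2\delta t}\left(\|u_0\|_{H^s_{\mathcal L}}^2+\|u_1\|_{H^{s-1}_{\mathcal L}}^2\right)\qquad\text{for all }t>0.$$ 2. For every $\alpha\in\mathbb N_0$ there is $C>0$, depending only on $n,b,m,s,\alpha$, such that for all $u_0\in H^{\alpha+s}_{\mathcal L}$, $u_1\in H^{\alpha+s-1}_{\mathcal L}$ and every solution $u$ of (1), the time derivative $\partial_t^\alpha u$ exists for $t>0$ in the sense of distributions on $\mathbb H^n$ (that is, $t\mapsto\langle u(t),\varphi\rangle$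 is $C^\alpha$ on $(0,\infty)$ for every test function $\varphi$, with $\alpha$-th derivative $\langle\partial_t^\alpha u(t),\varphi\rangle$), and $\partial_t^\alpha u(t)\in H^s_{\mathcal L}$ with $$\|\partial_t^\alpha u(t)\|_{H^s_{\mathcal L}}^2\le C e^{-2\delta t}\left(\|u_0\|_{H^{\alpha+s}_{\mathcal L}}^2+\|u_1\|_{H^{\alpha+s-1}_{\mathcal L}}^2\right)\qquad\text{for all }t>0.$$ -/

import Mathlib

open MeasureTheory Filter Topology TopologicalSpace Set
open scoped Distributions ContDiff ENNReal

noncomputable section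

namespace Heisenberg

/-- The power `T ^ a`, `a ≥ 0`, of a nonnegative bounded self-adjoint operator `T` on a complex Hilbert
space, in the sense of the continuous functional calculus (`T ^ 0 = I`). -/
def opPow {H : Type*} [NormedAddCommGroup H] [InnerProductSpace ℂ H] [CompleteSpace H]
    (T : H →L[ℂ] H) (a : ℝ) : H →L[ℂ] H :=
  cfc (fun r : ℝ => r ^ a) T

/-- The underlying manifold `ℝⁿ × ℝⁿ × ℝ` of the Heisenberg group `ℍⁿ`, with points `(x, y, τ)`. Its
Haar measure is the Lebesgue measure `volume`. The group law is
`(x, y, τ) ∘ (x', y', τ') = (x + x', y + y', τ + τ' + (x · y' - x' · y) / 2)`. -/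
abbrev Space (n : ℕ) : Type := EuclideanSpace ℝ (Fin n) × EuclideanSpace ℝ (Fin n) × ℝ

/-- The complex Hilbert space `L²(ℍⁿ)`. -/
abbrev L2 (n : ℕ) : Type := Lp ℂ 2 (volume : Measure (Space n))

/-- Real-valued test functions on `ℍⁿ`. -/
abbrev Test (n : ℕ) : Type := 𝓓((⊤ : Opens (Space n)), ℝ)

/-- Complex-valued distributions on `ℍⁿ` (it suffices to test against real test functions). -/
abbrev Distr (n : ℕ) : Type := 𝓓'((⊤ : Opens (Space n)), ℂ)

variable {n : ℕ}

/-- The derivative of a test function along a smooth vector field. -/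
def fieldDeriv (V : Space n → Space n) (hV : ContDiff ℝ ∞ V) (φ : Test n) : Test n where
  toFun p := fderiv ℝ φ p (V p)
  contDiff' := by
    have h : ContDiff ℝ ∞ (fderiv ℝ φ) := φ.contDiff.fderiv_right (by simp)
    exact h.clm_apply hV
  hasCompactSupport' := by
    refine (φ.hasCompactSupport.fderiv ℝ).mono ?_
    intro p hp h0
    exact hp (by simp [h0])
  tsupport_subset' := fun _ _ => trivial

/-- The left-invariant vector field `X_j = ∂_{x_j} - (y_j / 2) ∂_τ`. -/
def vecX (j : Fin n) (p : Space n) : Space n :=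
  (EuclideanSpace.single j 1, 0, -(p.2.1 j) / 2)

/-- The left-invariant vector field `Y_j = ∂_{y_j} + (x_j / 2) ∂_τ`. -/
def vecY (j : Fin n) (p : Space n) : Space n :=
  (0, EuclideanSpace.single j 1, (p.1 j) / 2)

theorem contDiff_vecX (j : Fin n) : ContDiff ℝ ∞ (vecX j) := by
  unfold vecX; fun_prop

theorem contDiff_vecY (j : Fin n) : ContDiff ℝ ∞ (vecY j) := by
  unfold vecY; fun_prop

/-- The test function `X_j φ`. -/
def X (j : Fin n) (φ : Test n) : Test n := fieldDeriv (vecX j) (contDiff_vecX j) φ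

/-- The test function `Y_j φ`. -/
def Y (j : Fin n) (φ : Test n) : Test n := fieldDeriv (vecY j) (contDiff_vecY j) φ

/-- The sub-Laplacian `𝓛 = ∑ j, (X_j² + Y_j²)` on test functions. It is its own formal transpose, so
it acts on distributions by `(𝓛 f) φ = f (𝓛 φ)`. -/
def subLaplacian (φ : Test n) : Test n := ∑ j, (X j (X j φ) + Y j (Y j φ))

/-- The class in `L²(ℍⁿ)` of a test function. -/
def toL2 (φ : Test n) : L2 n :=
  MemLp.toLp (fun p => (φ p : ℂ)) <|
    (Complex.continuous_ofReal.comp φ.continuous).memLp_of_hasCompactSupport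
      (φ.hasCompactSupport.comp_left Complex.ofReal_zero)

/-- `L²(ℍⁿ)` together with `2n` further copies of it, for the horizontal derivatives. -/
abbrev JetSpace (n : ℕ) : Type := PiLp 2 (fun _ : Option (Fin n ⊕ Fin n) => L2 n)

/-- The tuple `(φ, X_1 φ, …, X_n φ, Y_1 φ, …, Y_n φ)`. -/
def jet (φ : Test n) : JetSpace n := WithLp.toLp 2 fun
  | none => toL2 φ
  | some (Sum.inl j) => toL2 (X j φ)
  | some (Sum.inr j) => toL2 (Y j φ)

variable (n) in
/-- The domain of the quadratic form `‖v‖² + ∑ j, (‖X_j v‖² + ‖Y_j v‖²)` of `I - 𝓛`, that is, the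
completion of the (complexified) test functions in the norm of this form, realized as the closure of
the set of their jets. -/
abbrev formDomain : Submodule ℂ (JetSpace n) :=
  (Submodule.span ℂ (range (jet (n := n)))).topologicalClosure

instance : CompleteSpace (formDomain n) :=
  (Submodule.isClosed_topologicalClosure _).completeSpace_coe

variable (n) in
/-- The embedding of the form domain in `L²(ℍⁿ)`. -/
def formEmbed : formDomain n →L[ℂ] L2 n :=
  (PiLp.proj 2 (fun _ : Option (Fin n ⊕ Fin n) => L2 n) none).comp (formDomain n).subtypeL

variable (n) in
/-- The bounded operator `(I - 𝓛)⁻¹` on `L²(ℍⁿ)`, where `-𝓛` is the nonnegative self-adjoint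
operator of the closed quadratic form `∑ j, (‖X_j v‖² + ‖Y_j v‖²)`: for `f` in `L²(ℍⁿ)`, the adjoint
of the embedding gives the element `w` of the form domain with
`⟪w, v⟫ + ∑ j, (⟪X_j w, X_j v⟫ + ⟪Y_j w, Y_j v⟫) = ⟪f, v⟫` for all `v` in the form domain. -/
def subLaplacianResolvent : L2 n →L[ℂ] L2 n :=
  (formEmbed n).comp (ContinuousLinearMap.adjoint (formEmbed n))

/-- The element `(I - 𝓛)^σ φ` of `L²(ℍⁿ)`, for real `σ` and a test function `φ`. With the natural
number `k = ⌈σ⌉₊ ≥ σ` it is `((I - 𝓛)⁻¹)^(k - σ) (I - 𝓛)^k φ`, where `k - σ ≥ 0`. -/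
def besselTest (σ : ℝ) (φ : Test n) : L2 n :=
  opPow (subLaplacianResolvent n) ((⌈σ⌉₊ : ℝ) - σ)
    (toL2 ((fun ψ : Test n => ψ - subLaplacian ψ)^[⌈σ⌉₊] φ))

/-- `g = (I - 𝓛)^(s/2) f` for a distribution `f` and `g` in `L²(ℍⁿ)`: for all test functions `φ`,
`f φ = ∫ g · (I - 𝓛)^(-s/2) φ` (the factor `(I - 𝓛)^(-s/2) φ` is real-valued). -/
def IsBesselDeriv (s : ℝ) (f : Distr n) (g : L2 n) : Prop :=
  ∀ φ : Test n, f φ = inner ℂ (besselTest (-s / 2) φ) g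

/-- Membership in the Sobolev space `H^s_𝓛(ℍⁿ) = {f ∈ 𝓓'(ℍⁿ) : (I - 𝓛)^(s/2) f ∈ L²(ℍⁿ)}`. -/
def MemSobolev (s : ℝ) (f : Distr n) : Prop := ∃ g : L2 n, IsBesselDeriv s f g

/-- The norm `‖f‖_{H^s_𝓛} = ‖(I - 𝓛)^(s/2) f‖_{L²}`, with value `∞` if `f` is not in
`H^s_𝓛(ℍⁿ)`. -/
def sobolevNorm (s : ℝ) (f : Distr n) : ℝ≥0∞ := ⨅ (g : L2 n) (_ : IsBesselDeriv s f g), ‖g‖ₑ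

/-- `u` belongs to `C([0, ∞); H^r_𝓛(ℍⁿ))`. -/
def ContinuousInSobolev (r : ℝ) (u : ℝ → Distr n) : Prop :=
  ∀ t, 0 ≤ t → MemSobolev r (u t) ∧
    Tendsto (fun τ => sobolevNorm r (u τ - u t)) (𝓝[Ici 0] t) (𝓝 0)

/-- `v` is the time derivative of `u` in `H^r_𝓛(ℍⁿ)` on `[0, ∞)` (one-sided at `0`). -/
def HasTimeDerivInSobolev (r : ℝ) (u v : ℝ → Distr n) : Prop :=
  ∀ t, 0 ≤ t →
    Tendsto (fun τ => sobolevNorm r ((τ - t)⁻¹ • (u τ - u t) - v t)) (𝓝[Ici 0 \ {t}] t) (𝓝 0)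

/-- `u` solves `∂ₜ² u - 𝓛 u + b ∂ₜ u + m u = 0` for `t > 0`, `u(0) = u₀`, `∂ₜ u(0) = u₁`: at some
Sobolev level `r ∈ ℝ`, which is not tied to the data, `u` is in
`C([0, ∞); H^r_𝓛) ∩ C¹([0, ∞); H^{r-1}_𝓛)`, with time derivative `v`, and the equation holds in the
sense of distributions. Only the values of `u` on `[0, ∞)` matter. -/
def IsSolution (b m : ℝ) (u₀ u₁ : Distr n) (u : ℝ → Distr n) : Prop :=
  ∃ (r : ℝ) (v : ℝ → Distr n),
    ContinuousInSobolev r u ∧ ContinuousInSobolev (r - 1) v ∧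
    HasTimeDerivInSobolev (r - 1) u v ∧
    (∀ φ : Test n, ∀ t, 0 < t →
      HasDerivAt (fun τ => v τ φ) (u t (subLaplacian φ) - b * v t φ - m * u t φ) t) ∧
    u 0 = u₀ ∧ v 0 = u₁

/-- `w = ∂ₜ^α u` for `t > 0`, in the sense of distributions on `ℍⁿ`: for each test function `φ`, the
function `t ↦ ⟨u(t), φ⟩` is `α` times continuously differentiable on `(0, ∞)`, with `α`-th derivative
`t ↦ ⟨w(t), φ⟩`. -/
def IsTimeDeriv (α : ℕ) (u w : ℝ → Distr n) : Prop :=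
  ∀ φ : Test n, ContDiffOn ℝ α (fun t => u t φ) (Ioi 0) ∧
    ∀ t, 0 < t → w t φ = iteratedDeriv α (fun τ => u τ φ) t

end Heisenberg

end

/-!
The operator `I - 𝓛` enters only through the positive injective contraction
`R = (I - 𝓛)⁻¹` on `L²`. If `G` and `K` represent `u` in `H^s` and `∂ₜ u` in `H^(s-1)`, that is
`G = (I - 𝓛)^(s/2) u` and `K = (I - 𝓛)^((s-1)/2) ∂ₜ u`, then the equation says that, after a loss of
one order, `(G, K)` has the time derivative `(K, -G + (1 - m) R G - b R^(1/2) K)`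
(`waveGen`, `IsEvolution`). The orders of regularity have disappeared from this system, so that one
energy estimate, with constants depending on `b` and `m` only, serves for all `s`.

**Energy.** For `w = R G`, `y = R^(1/2) G`, `p = R^(1/2) K` the functional
`‖p‖² + ‖y‖² + (m - 1) ‖w‖² + b ⟪w, p⟫ + (b²/2) ‖w‖²` has the derivative
`-b (‖p‖² + ‖y‖² + (m - 1) ‖w‖²)`. As `‖w‖ ≤ ‖y‖`, both are comparable with `‖y‖² + ‖p‖²`, also for
`m < 1`, and exponential decay follows (`energy_decay`).

**Arbitrary solutions.** A solution is only known to exist at some low order, where its data lie in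
the range of a power `R^N`. The energy estimate, applied to differences of the regularizations
`(R + ε)^(-N) V` of the solution, shows that these converge as `ε → 0`; the limit represents the
solution at the order of its data and inherits the decay (`IsEvolution.exists_preimage`). No
existence theory and no formula for the propagator is needed. Time derivatives are powers of
`waveGen` applied to the representative (`IsEvolution.hasDerivAt_waveGen_pow`), and `waveGen` is bounded.

**Uniqueness of representatives.** All of this needs the elements `(I - 𝓛)^σ φ`, for test functions
`φ`, to be total in `L²`, that is, the essential self-adjointness of the powers of `I - 𝓛`
(`eq_zero_of_inner_oneSubLap_iterate`). Let `g` in `L²` annihilate `(I - 𝓛)^(k+1) φ` for all `φ`,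
and put `f φ = ⟪(I - 𝓛)^k φ, g⟫`. For fixed `φ`, the function `x ↦ f (φ (· ∘ x))` on the group is
smooth along the horizontal one-parameter subgroups, has polynomial growth since left-invariant fields are
conjugated by right translations to fields with polynomial coefficients, and is annihilated by
`I - 𝓛̃`, where `𝓛̃` is the right-invariant sub-Laplacian. A high power of the gauge
`M + (|x|² + |y|²)² + τ²` is a supersolution for large `M` (`sum_gauge_le`), so the maximum
principle shows that the function vanishes (`Tame.eq_zero`), and `k` is reduced by one.
-/

noncomputable section

namespace Heisenberg

section

variable {n : ℕ}

/-! ### Translations and left-invariant fields -/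

/-- The symplectic form `ω(p, q) = x · y' - x' · y`, which is the `τ`-component of the commutator of
`p` and `q`. -/
def symp (p q : Space n) : ℝ := inner ℝ p.1 q.2.1 - inner ℝ q.1 p.2.1

/-- The group law of `ℍⁿ`. -/
def mul (p q : Space n) : Space n := (p.1 + q.1, p.2.1 + q.2.1, p.2.2 + q.2.2 + symp p q / 2)

/-- The left-invariant vector field with value `e` at the origin. -/
def leftField (e p : Space n) : Space n := (e.1, e.2.1, e.2.2 + symp p e / 2)

/-- The central direction `∂_τ`. -/
def center : Space n := (0, 0, 1)

theorem symp_add_left (p q r : Space n) : symp (p + q) r = symp p r + symp q r := by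
  simp [symp, inner_add_left, inner_add_right]; ring

theorem symp_smul_left (t : ℝ) (p r : Space n) : symp (t • p) r = t * symp p r := by
  simp [symp, inner_smul_left, inner_smul_right]; ring

theorem symp_swap (p q : Space n) : symp q p = - symp p q := by
  simp [symp]

theorem symp_self (p : Space n) : symp p p = 0 := by simp [symp]

theorem symp_smul_right (t : ℝ) (p r : Space n) : symp p (t • r) = t * symp p r := by
  rw [symp_swap, symp_smul_left, symp_swap p r]; ring

theorem symp_add_right (p q r : Space n) : symp r (p + q) = symp r p + symp r q := by
  rw [symp_swap, symp_add_left, symp_swap r p, symp_swap r q]; ring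

theorem symp_leftField (e p q : Space n) : symp (leftField e p) q = symp e q := rfl

theorem symp_mul_left (p q r : Space n) : symp (mul p q) r = symp p r + symp q r := by
  rw [← symp_add_left]; rfl

theorem symp_mul_right (p q r : Space n) : symp r (mul p q) = symp r p + symp r q := by
  rw [← symp_add_right]; rfl

theorem mul_assoc' (p q r : Space n) : mul (mul p q) r = mul p (mul q r) := by
  refine Prod.ext (by simp [mul, add_assoc]) (Prod.ext (by simp [mul, add_assoc]) ?_)
  change p.2.2 + q.2.2 + symp p q / 2 + r.2.2 + symp (mul p q) r / 2
    = p.2.2 + (q.2.2 + r.2.2 + symp q r / 2) + symp p (mul q r) / 2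
  rw [symp_mul_left, symp_mul_right]; ring

theorem mul_smul_eq (p e : Space n) (t : ℝ) : mul p (t • e) = p + t • leftField e p := by
  refine Prod.ext (by simp [mul, leftField]) (Prod.ext (by simp [mul, leftField]) ?_)
  simp only [mul, leftField, Prod.snd_add, Prod.smul_snd, smul_eq_mul, symp_smul_right]; ring

theorem mul_zero' (p : Space n) : mul p 0 = p := by
  simpa using mul_smul_eq p 0 0

theorem zero_mul' (p : Space n) : mul 0 p = p := by
  simp [mul, symp]

theorem mul_neg_cancel (p x : Space n) : mul (mul p x) (-x) = p := by
  rw [mul_assoc']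
  have : mul x (-x) = 0 := by
    have := mul_smul_eq x x (-1)
    rw [neg_one_smul] at this
    rw [this]
    refine Prod.ext (by simp [leftField]) (Prod.ext (by simp [leftField]) ?_)
    simp [leftField, symp_self]
  rw [this, mul_zero']

theorem mul_neg_cancel' (p x : Space n) : mul (mul p (-x)) x = p := by
  simpa using mul_neg_cancel p (-x)

theorem leftField_mul_smul (e p : Space n) (t : ℝ) :
    leftField e (mul p (t • e)) = leftField e p := by
  simp only [leftField, symp_mul_left, symp_smul_left, symp_self, mul_zero, add_zero]

theorem mul_line (z v x : Space n) (t : ℝ) :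
    mul (z + t • v) x = mul z x + t • (v.1, v.2.1, v.2.2 + symp v x / 2) := by
  refine Prod.ext ?_ (Prod.ext ?_ ?_)
  · simp [mul]; abel
  · simp [mul]; abel
  · simp only [mul, Prod.snd_add, Prod.smul_snd, smul_eq_mul, symp_add_left, symp_smul_left]; ring

theorem contDiff_mul : ContDiff ℝ ∞ (fun p : Space n × Space n => mul p.1 p.2) := by
  have h (u v : Space n × Space n → EuclideanSpace ℝ (Fin n)) (hu : ContDiff ℝ ∞ u)
      (hv : ContDiff ℝ ∞ v) : ContDiff ℝ ∞ (fun p => inner ℝ (u p) (v p)) := hu.inner ℝ hv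
  unfold mul symp
  refine ContDiff.prodMk (by fun_prop) (ContDiff.prodMk (by fun_prop) ?_)
  refine ContDiff.add (by fun_prop) (ContDiff.div_const (ContDiff.sub ?_ ?_) 2)
  · exact h _ _ (by fun_prop) (by fun_prop)
  · exact h _ _ (by fun_prop) (by fun_prop)

theorem continuous_mul' : Continuous (fun p : Space n × Space n => mul p.1 p.2) :=
  contDiff_mul.continuous

theorem contDiff_leftField (e : Space n) : ContDiff ℝ ∞ (leftField e) := by
  have h : leftField e = fun p => mul p e - p := by
    funext p
    have := mul_smul_eq p e 1
    rw [one_smul, one_smul] at this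
    rw [this]; abel
  rw [h]
  exact (contDiff_mul.comp (contDiff_id.prodMk contDiff_const)).sub contDiff_id

/-- Right translation by `x`. -/
def mulRight (x : Space n) : Space n ≃ₜ Space n where
  toFun z := mul z x
  invFun z := mul z (-x)
  left_inv z := mul_neg_cancel z x
  right_inv z := mul_neg_cancel' z x
  continuous_toFun := continuous_mul'.comp (continuous_id.prodMk continuous_const)
  continuous_invFun := continuous_mul'.comp (continuous_id.prodMk continuous_const)

/-- The test function `z ↦ φ (z ∘ x)`. -/
def translate (x : Space n) : Test n →ₗ[ℝ] Test n where
  toFun φ :=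
    { toFun := fun z => φ (mul z x)
      contDiff' := φ.contDiff.comp (contDiff_mul.comp (contDiff_id.prodMk contDiff_const))
      hasCompactSupport' := φ.hasCompactSupport.comp_homeomorph (mulRight x)
      tsupport_subset' := fun _ _ => trivial }
  map_add' φ ψ := by ext z; rfl
  map_smul' c φ := by ext z; rfl

@[simp] theorem translate_apply (x z : Space n) (φ : Test n) : translate x φ z = φ (mul z x) := rfl

theorem translate_translate (x y : Space n) (φ : Test n) :
    translate x (translate y φ) = translate (mul x y) φ := by
  ext z; simp [mul_assoc']

theorem translate_zero (φ : Test n) : translate 0 φ = φ := by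
  ext z; simp [mul_zero']

theorem differentiable_test (φ : Test n) : Differentiable ℝ φ := φ.contDiff.differentiable (by simp)

/-- The left-invariant derivative of test functions in the direction `e`. -/
def D (e : Space n) : Test n →ₗ[ℝ] Test n where
  toFun φ := fieldDeriv (leftField e) (contDiff_leftField e) φ
  map_add' φ ψ := by
    ext z
    change fderiv ℝ (φ + ψ : Space n → ℝ) z _ = fderiv ℝ φ z _ + fderiv ℝ ψ z _
    rw [fderiv_add (differentiable_test φ z) (differentiable_test ψ z)]; rfl
  map_smul' c φ := by
    ext z
    change fderiv ℝ (c • φ : Space n → ℝ) z _ = c • fderiv ℝ φ z _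
    rw [fderiv_const_smul (differentiable_test φ z)]; rfl

theorem D_apply (e z : Space n) (φ : Test n) : D e φ z = fderiv ℝ φ z (leftField e z) := rfl

theorem X_eq_D (j : Fin n) (φ : Test n) : X j φ = D (EuclideanSpace.single j 1, 0, 0) φ := by
  ext z
  change fderiv ℝ φ z _ = fderiv ℝ φ z _
  congr 1
  simp [vecX, leftField, symp, EuclideanSpace.inner_single_left]

theorem Y_eq_D (j : Fin n) (φ : Test n) : Y j φ = D (0, EuclideanSpace.single j 1, 0) φ := by
  ext z
  change fderiv ℝ φ z _ = fderiv ℝ φ z _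
  congr 1
  simp [vecY, leftField, symp, EuclideanSpace.inner_single_right]

theorem hasDerivAt_line (φ : Test n) (p v : Space n) (t : ℝ) :
    HasDerivAt (fun t : ℝ => φ (p + t • v)) (fderiv ℝ φ (p + t • v) v) t := by
  have h1 : HasDerivAt (fun t : ℝ => p + t • v) v t := by
    simpa using ((hasDerivAt_id t).smul_const v).const_add p
  exact (differentiable_test φ _).hasFDerivAt.comp_hasDerivAt t h1

theorem hasDerivAt_mul_smul (φ : Test n) (e z : Space n) (t : ℝ) :
    HasDerivAt (fun t : ℝ => φ (mul z (t • e))) (D e φ (mul z (t • e))) t := by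
  rw [D_apply, leftField_mul_smul]
  simp only [mul_smul_eq]
  exact hasDerivAt_line φ z _ t

theorem fderiv_translate (x z v : Space n) (φ : Test n) :
    fderiv ℝ (translate x φ) z v
      = fderiv ℝ φ (mul z x) (v.1, v.2.1, v.2.2 + symp v x / 2) := by
  have h1 := hasDerivAt_line (translate x φ) z v 0
  have h2 := hasDerivAt_line φ (mul z x) (v.1, v.2.1, v.2.2 + symp v x / 2) 0
  simp only [translate_apply, mul_line] at h1
  simpa using h1.unique h2

/-- Right translations conjugate left-invariant fields by the adjoint representation. -/
theorem D_translate (e x : Space n) (φ : Test n) :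
    D e (translate x φ) = translate x (D e φ) + symp e x • translate x (D center φ) := by
  ext z
  change fderiv ℝ (translate x φ) z (leftField e z)
    = fderiv ℝ φ (mul z x) (leftField e (mul z x))
      + symp e x • fderiv ℝ φ (mul z x) (leftField center (mul z x))
  rw [fderiv_translate, ← map_smul, ← map_add]
  congr 1
  refine Prod.ext (by simp [leftField, center]) (Prod.ext (by simp [leftField, center]) ?_)
  have : symp (mul z x) center = 0 := by simp [symp, center]
  simp only [symp_leftField, Prod.snd_add, Prod.smul_snd]
  simp only [leftField, this, symp_mul_left, symp_swap e x]
  simp [center]; ring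

theorem fderiv_leftField (e p v : Space n) : fderiv ℝ (leftField e) p v = (0, 0, symp v e / 2) := by
  have h1 : HasDerivAt (fun t : ℝ => leftField e (p + t • v))
      (fderiv ℝ (leftField e) (p + (0 : ℝ) • v) v) 0 := by
    have h1 : HasDerivAt (fun t : ℝ => p + t • v) v 0 := by
      simpa using ((hasDerivAt_id (0 : ℝ)).smul_const v).const_add p
    exact ((contDiff_leftField e).differentiable (by simp) _).hasFDerivAt.comp_hasDerivAt 0 h1
  have h2 : HasDerivAt (fun t : ℝ => leftField e (p + t • v)) (0, 0, symp v e / 2) 0 := by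
    have h3 : (fun t : ℝ => leftField e (p + t • v))
        = fun t : ℝ => leftField e p + t • ((0, 0, symp v e / 2) : Space n) := by
      funext t
      refine Prod.ext (by simp [leftField]) (Prod.ext (by simp [leftField]) ?_)
      simp only [leftField, Prod.snd_add, Prod.smul_snd, smul_eq_mul, symp_add_left,
        symp_smul_left]; ring
    rw [h3]
    simpa using ((hasDerivAt_id (0 : ℝ)).smul_const ((0, 0, symp v e / 2) : Space n)).const_add
      (leftField e p)
  simpa using h1.unique h2

theorem D_D_apply (e e' z : Space n) (φ : Test n) :
    D e (D e' φ) z = fderiv ℝ (fderiv ℝ φ) z (leftField e z) (leftField e' z)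
      + (symp e e' / 2) * fderiv ℝ φ z center := by
  have hd : DifferentiableAt ℝ (fderiv ℝ φ) z :=
    (φ.contDiff.fderiv_right (m := ∞) (by simp)).differentiable (by simp) z
  have h := hd.hasFDerivAt.clm_apply
    ((contDiff_leftField e').differentiable (by simp) z).hasFDerivAt
  have h' : fderiv ℝ (D e' φ) z = _ := h.fderiv
  rw [D_apply, h']
  simp only [add_apply, ContinuousLinearMap.comp_apply,
    ContinuousLinearMap.flip_apply, fderiv_leftField, symp_leftField]
  rw [add_comm]
  congr 1
  rw [← smul_eq_mul, ← map_smul]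
  congr 1
  simp [center]

/-- The commutation relations, from the symmetry of second derivatives. -/
theorem D_commutator (e e' : Space n) (φ : Test n) :
    D e (D e' φ) - D e' (D e φ) = symp e e' • D center φ := by
  ext z
  change D e (D e' φ) z - D e' (D e φ) z = symp e e' • D center φ z
  have hs : IsSymmSndFDerivAt ℝ φ z := φ.contDiff.contDiffAt.isSymmSndFDerivAt
    (by simpa using
      (WithTop.coe_le_coe.2 le_top : ((2 : ℕ∞) : WithTop ℕ∞) ≤ ((⊤ : ℕ∞) : WithTop ℕ∞)))
  have hc : leftField center z = center := by simp [leftField, center, symp]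
  rw [D_D_apply, D_D_apply, D_apply, hc, hs.eq, symp_swap e e', smul_eq_mul]
  ring

/-! ### Pairings of test functions with functions on the group -/

theorem integrable_test_smul {g : Space n → ℂ} (hg : LocallyIntegrable g volume) (φ : Test n) :
    Integrable (fun z => φ z • g z) volume :=
  hg.integrable_smul_left_of_hasCompactSupport φ.continuous φ.hasCompactSupport

/-- The functional `φ ↦ ∫ φ g` of a locally integrable function `g`. -/
def pairing (g : Space n → ℂ) (hg : LocallyIntegrable g volume) : Test n →ₗ[ℝ] ℂ where
  toFun φ := ∫ z, φ z • g z
  map_add' φ ψ := by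
    rw [← integral_add (integrable_test_smul hg φ) (integrable_test_smul hg ψ)]
    congr 1; funext z
    exact add_smul _ _ _
  map_smul' c φ := by
    rw [RingHom.id_apply, ← integral_smul]
    congr 1; funext z
    exact smul_assoc c (φ z) (g z)

theorem pairing_apply (g : Space n → ℂ) (hg : LocallyIntegrable g volume) (φ : Test n) :
    pairing g hg φ = ∫ z, φ z • g z := rfl

/-- Translates by a compact set of group elements are dominated by one integrable function. -/
theorem exists_bound_translate {g : Space n → ℂ} (hg : LocallyIntegrable g volume) (φ : Test n)
    {P : Set (Space n)} (hP : IsCompact P) :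
    ∃ bound : Space n → ℝ, Integrable bound volume ∧
      ∀ x ∈ P, ∀ z, ‖φ (mul z x) • g z‖ ≤ bound z := by
  have hc : IsCompact ((fun q : Space n × Space n => mul q.1 (-q.2)) '' (tsupport φ ×ˢ P)) :=
    (φ.hasCompactSupport.isCompact.prod hP).image
      (continuous_mul'.comp (continuous_fst.prodMk continuous_snd.neg))
  set K := (fun q : Space n × Space n => mul q.1 (-q.2)) '' (tsupport φ ×ˢ P) with hK
  obtain ⟨M, hM⟩ := φ.continuous.bounded_above_of_compact_support φ.hasCompactSupport
  refine ⟨K.indicator fun z => M * ‖g z‖,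
    (integrable_indicator_iff hc.measurableSet).2
      ((hg.integrableOn_isCompact hc).norm.const_mul M), ?_⟩
  intro x hx z
  by_cases hz : z ∈ K
  · rw [indicator_of_mem hz, norm_smul]
    exact mul_le_mul_of_nonneg_right (hM _) (norm_nonneg _)
  · rw [indicator_of_notMem hz]
    have : φ (mul z x) = 0 := by
      by_contra h
      exact hz ⟨(mul z x, x), ⟨subset_tsupport _ h, hx⟩, mul_neg_cancel z x⟩
    simp [this]

theorem hasDerivAt_pairing_translate {g : Space n → ℂ} (hg : LocallyIntegrable g volume)
    (e : Space n) (φ : Test n) :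
    HasDerivAt (fun t : ℝ => pairing g hg (translate (t • e) φ)) (pairing g hg (D e φ)) 0 := by
  have hP : IsCompact ((fun t : ℝ => t • e) '' Icc (-1) 1) := isCompact_Icc.image (by fun_prop)
  obtain ⟨bound, hb, hbd⟩ := exists_bound_translate hg (D e φ) hP
  have key := hasDerivAt_integral_of_dominated_loc_of_deriv_le (μ := volume) (x₀ := (0 : ℝ))
    (s := Icc (-1) 1) (F := fun t z => translate (t • e) φ z • g z)
    (F' := fun t z => translate (t • e) (D e φ) z • g z) (bound := bound)
    (Icc_mem_nhds (by norm_num) (by norm_num))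
    (Eventually.of_forall fun t => (integrable_test_smul hg _).aestronglyMeasurable)
    (integrable_test_smul hg _) (integrable_test_smul hg _).aestronglyMeasurable
    (Eventually.of_forall fun z t ht => hbd _ ⟨t, ht, rfl⟩ z) hb
    (Eventually.of_forall fun z t _ => (hasDerivAt_mul_smul φ e z t).smul_const (g z))
  have := key.2
  simp only [zero_smul, translate_zero] at this
  exact this

theorem continuous_pairing_translate {g : Space n → ℂ} (hg : LocallyIntegrable g volume)
    (φ : Test n) : Continuous fun x => pairing g hg (translate x φ) := by
  rw [continuous_iff_continuousAt]
  intro x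
  obtain ⟨bound, hb, hbd⟩ := exists_bound_translate hg φ (isCompact_closedBall x 1)
  refine continuousAt_of_dominated (bound := bound)
    (Eventually.of_forall fun t => (integrable_test_smul hg _).aestronglyMeasurable) ?_ hb ?_
  · filter_upwards [Metric.closedBall_mem_nhds x one_pos] with y hy
    exact Eventually.of_forall fun z => hbd y hy z
  · refine Eventually.of_forall fun z => ?_
    have : Continuous fun y => φ (mul z y) • g z :=
      (φ.continuous.comp (continuous_mul'.comp (continuous_const.prodMk continuous_id))).smul
        continuous_const
    exact this.continuousAt

/-! ### Invariance of the measure and integration by parts -/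

/-- Right translations are shears, hence preserve Lebesgue measure. -/
theorem measurePreserving_mulRight (x : Space n) :
    MeasurePreserving (fun z : Space n => mul z x) volume volume := by
  have hsk : MeasurePreserving
      (fun z : Space n => (z.1 + x.1, (fun w : EuclideanSpace ℝ (Fin n) × ℝ =>
        (w.1 + x.2.1, w.2 + (x.2.2 + symp (z.1, w.1, (0 : ℝ)) x / 2))) z.2))
      (volume.prod (volume.prod volume)) (volume.prod (volume.prod volume)) := by
    have hm : Continuous (fun z : Space n => symp (z.1, z.2.1, (0 : ℝ)) x) := by
      unfold symp; fun_prop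
    refine (measurePreserving_add_right volume x.1).skew_product
      (g := fun (a : EuclideanSpace ℝ (Fin n)) (w : EuclideanSpace ℝ (Fin n) × ℝ) =>
        (w.1 + x.2.1, w.2 + (x.2.2 + symp (a, w.1, (0 : ℝ)) x / 2))) ?_ ?_
    · refine Continuous.measurable ?_
      refine Continuous.prodMk (by fun_prop) (Continuous.add (by fun_prop)
        (Continuous.add (by fun_prop) (Continuous.div_const ?_ 2)))
      exact hm
    · refine Eventually.of_forall fun a => ?_
      have hm' : Continuous (fun b : EuclideanSpace ℝ (Fin n) => symp (a, b, (0 : ℝ)) x) := by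
        unfold symp; fun_prop
      refine ((measurePreserving_add_right volume x.2.1).skew_product
        (g := fun (b : EuclideanSpace ℝ (Fin n)) (s : ℝ) =>
          s + (x.2.2 + symp (a, b, (0 : ℝ)) x / 2)) ?_ ?_).map_eq
      · refine Continuous.measurable ?_
        exact Continuous.add (by fun_prop)
          (Continuous.add (by fun_prop) (Continuous.div_const (hm'.comp continuous_fst) 2))
      · exact Eventually.of_forall fun b => (measurePreserving_add_right volume _).map_eq
  have heq : (fun z : Space n => mul z x) = fun z : Space n => (z.1 + x.1,
      (fun w : EuclideanSpace ℝ (Fin n) × ℝ =>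
        (w.1 + x.2.1, w.2 + (x.2.2 + symp (z.1, w.1, (0 : ℝ)) x / 2))) z.2) := by
    funext z
    refine Prod.ext rfl (Prod.ext rfl ?_)
    change z.2.2 + x.2.2 + symp z x / 2 = z.2.2 + (x.2.2 + symp z x / 2)
    ring
  rw [heq]
  exact hsk

theorem integral_comp_mulRight {E : Type*} [NormedAddCommGroup E] [NormedSpace ℝ E] (x : Space n)
    (f : Space n → E) : ∫ z, f (mul z x) = ∫ z, f z :=
  (measurePreserving_mulRight x).integral_comp (mulRight x).measurableEmbedding f

theorem locallyIntegrable_test (φ : Test n) :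
    LocallyIntegrable (fun z => (φ z : ℂ)) volume :=
  (Complex.continuous_ofReal.comp φ.continuous).locallyIntegrable

/-- The left-invariant fields are skew-symmetric: differentiate the translation invariance of the
integral of `φ ψ`. -/
theorem pairing_D_test (e : Space n) (φ ψ : Test n) :
    pairing _ (locallyIntegrable_test ψ) (D e φ)
      = - pairing _ (locallyIntegrable_test φ) (D e ψ) := by
  have h1 := hasDerivAt_pairing_translate (locallyIntegrable_test ψ) e φ
  have h2 := (hasDerivAt_pairing_translate (locallyIntegrable_test φ) e ψ)
  have h3 : HasDerivAt (fun t : ℝ => -t) (-1) 0 := hasDerivAt_neg 0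
  have h4 := HasDerivAt.scomp (0 : ℝ) (by simpa using h2) h3
  suffices h5 : (fun t : ℝ => pairing _ (locallyIntegrable_test ψ) (translate (t • e) φ)) =
      (fun t => pairing _ (locallyIntegrable_test φ) (translate (t • e) ψ)) ∘ fun t => -t by
    rw [← h5] at h4
    rw [h1.unique h4, neg_smul, one_smul]
  funext t
  simp only [Function.comp, pairing_apply, translate_apply]
  rw [← integral_comp_mulRight (-(t • e)) (fun z => φ (mul z (t • e)) • (ψ z : ℂ))]
  congr 1; funext z
  rw [mul_neg_cancel']
  simp [mul_comm]

theorem inner_toL2 (φ : Test n) (g : L2 n) :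
    inner ℂ (toL2 φ) g = ∫ z, φ z • g z := by
  rw [L2.inner_def]
  refine integral_congr_ae ?_
  have : toL2 φ =ᵐ[volume] fun p => (φ p : ℂ) := MemLp.coeFn_toLp _
  filter_upwards [this] with z hz
  rw [hz]
  simp [mul_comm]

theorem locallyIntegrable_L2 (g : L2 n) : LocallyIntegrable g volume :=
  (Lp.memLp g).locallyIntegrable (by norm_num)

/-- Pairing with an element of `L²`. -/
def pairL2 (g : L2 n) : Test n →ₗ[ℝ] ℂ := pairing g (locallyIntegrable_L2 g)

theorem pairL2_apply (g : L2 n) (φ : Test n) : pairL2 g φ = inner ℂ (toL2 φ) g :=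
  (inner_toL2 φ g).symm

theorem inner_toL2_toL2 (φ ψ : Test n) :
    inner ℂ (toL2 φ) (toL2 ψ) = pairing _ (locallyIntegrable_test ψ) φ := by
  rw [inner_toL2, pairing_apply]
  refine integral_congr_ae ?_
  have : toL2 ψ =ᵐ[volume] fun p => (ψ p : ℂ) := MemLp.coeFn_toLp _
  filter_upwards [this] with z hz
  rw [hz]

theorem inner_toL2_comm (φ ψ : Test n) :
    inner ℂ (toL2 φ) (toL2 ψ) = inner ℂ (toL2 ψ) (toL2 φ) := by
  simp only [inner_toL2_toL2, pairing_apply]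
  congr 1; funext z; simp [mul_comm]

theorem inner_toL2_D (e : Space n) (φ ψ : Test n) :
    inner ℂ (toL2 (D e φ)) (toL2 ψ) = - inner ℂ (toL2 φ) (toL2 (D e ψ)) := by
  rw [inner_toL2_comm φ, inner_toL2_toL2, inner_toL2_toL2, pairing_D_test]

theorem toL2_add (φ ψ : Test n) : toL2 (φ + ψ) = toL2 φ + toL2 ψ := by
  rw [toL2, toL2, toL2, ← MemLp.toLp_add]
  congr 1
  funext z; simp

theorem toL2_smul (c : ℝ) (φ : Test n) : toL2 (c • φ) = (c : ℂ) • toL2 φ := by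
  rw [toL2, toL2, ← MemLp.toLp_const_smul]
  congr 1
  funext z; simp

/-- `toL2` as a real-linear map. -/
def toL2Lin : Test n →ₗ[ℝ] L2 n where
  toFun := toL2
  map_add' := toL2_add
  map_smul' c φ := by rw [toL2_smul]; rfl

theorem norm_toL2_translate (x : Space n) (φ : Test n) : ‖toL2 (translate x φ)‖ = ‖toL2 φ‖ := by
  have h (φ : Test n) : (‖toL2 φ‖ ^ 2 : ℂ) = ∫ z, (fun z => φ z • (φ z : ℂ)) z := by
    have := inner_self_eq_norm_sq_to_K (𝕜 := ℂ) (toL2 φ)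
    rw [inner_toL2_toL2, pairing_apply] at this
    exact this.symm
  have h1 : (‖toL2 (translate x φ)‖ ^ 2 : ℂ) = ‖toL2 φ‖ ^ 2 := by
    rw [h φ, ← integral_comp_mulRight x, h]
    rfl
  have h2 : ‖toL2 (translate x φ)‖ ^ 2 = ‖toL2 φ‖ ^ 2 := by exact_mod_cast h1
  exact (pow_left_inj₀ (norm_nonneg _) (norm_nonneg _) two_ne_zero).1 h2

/-- Test functions are dense in `L²`. -/
theorem eq_zero_of_inner_toL2 (g : L2 n) (h : ∀ φ : Test n, inner ℂ (toL2 φ) g = 0) : g = 0 := by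
  refine (Lp.eq_zero_iff_ae_eq_zero).2 ?_
  refine ae_eq_zero_of_integral_contDiff_smul_eq_zero (locallyIntegrable_L2 g) ?_
  intro φ hφ hc
  have := h ⟨φ, hφ, hc, fun _ _ => trivial⟩
  rw [inner_toL2] at this
  exact this

/-! ### The resolvent on test functions -/

variable (n) in
/-- The sub-Laplacian as a linear map on test functions. -/
def lap : Test n →ₗ[ℝ] Test n :=
  ∑ j, (D (EuclideanSpace.single j 1, 0, 0) ∘ₗ D (EuclideanSpace.single j 1, 0, 0)
    + D (0, EuclideanSpace.single j 1, 0) ∘ₗ D (0, EuclideanSpace.single j 1, 0))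

theorem subLaplacian_eq_lap (φ : Test n) : subLaplacian φ = lap n φ := by
  simp [subLaplacian, lap, X_eq_D, Y_eq_D, LinearMap.sum_apply]

variable (n) in
/-- The operator `I - 𝓛` on test functions. -/
def oneSubLap : Test n →ₗ[ℝ] Test n := LinearMap.id - lap n

theorem oneSubLap_apply (φ : Test n) : oneSubLap n φ = φ - subLaplacian φ := by
  simp [oneSubLap, subLaplacian_eq_lap]

/-- Integration by parts: the quadratic form of `I - 𝓛` on jets of test functions. -/
theorem inner_jet (φ ψ : Test n) :
    inner ℂ (jet ψ) (jet φ) = inner ℂ (toL2 ψ) (toL2 (oneSubLap n φ)) := by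
  have hlin : toL2 (oneSubLap n φ) = toL2 φ - ∑ j, (toL2 (X j (X j φ)) + toL2 (Y j (Y j φ))) := by
    change toL2Lin _ = toL2Lin φ - ∑ j, (toL2Lin (X j (X j φ)) + toL2Lin (Y j (Y j φ)))
    rw [oneSubLap_apply, map_sub, subLaplacian, map_sum]
    simp only [map_add]
  rw [hlin, inner_sub_right, inner_sum, PiLp.inner_apply, Fintype.sum_option, Fintype.sum_sum_type]
  simp only [jet, inner_add_right, Finset.sum_add_distrib]
  have hX : ∀ j, inner ℂ (toL2 (X j ψ)) (toL2 (X j φ)) = - inner ℂ (toL2 ψ) (toL2 (X j (X j φ))) :=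
    fun j => by rw [X_eq_D, X_eq_D, X_eq_D, inner_toL2_D]
  have hY : ∀ j, inner ℂ (toL2 (Y j ψ)) (toL2 (Y j φ)) = - inner ℂ (toL2 ψ) (toL2 (Y j (Y j φ))) :=
    fun j => by rw [Y_eq_D, Y_eq_D, Y_eq_D, inner_toL2_D]
  simp only [hX, hY, Finset.sum_neg_distrib]
  ring

theorem jet_mem (φ : Test n) : jet φ ∈ formDomain n :=
  Submodule.le_topologicalClosure _ (Submodule.subset_span ⟨φ, rfl⟩)

/-- The jets of test functions are total in the form domain. -/
theorem formDomain_eq_zero (v : formDomain n)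
    (h : ∀ ψ : Test n, inner ℂ (jet ψ) (v : JetSpace n) = 0) : v = 0 := by
  have h1 : (v : JetSpace n) ∈ (Submodule.span ℂ (range (jet (n := n))))ᗮ := by
    rw [Submodule.mem_orthogonal]
    intro u hu
    induction hu using Submodule.span_induction with
    | mem x hx => obtain ⟨ψ, rfl⟩ := hx; exact h ψ
    | zero => simp
    | add x y _ _ hx hy => rw [inner_add_left, hx, hy, add_zero]
    | smul c x _ hx => rw [inner_smul_left, hx, mul_zero]
  rw [← Submodule.orthogonal_closure] at h1
  have h2 : (v : JetSpace n) = 0 :=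
    inner_self_eq_zero.1 ((Submodule.mem_orthogonal _ _).1 h1 _ v.2)
  exact Subtype.ext h2

theorem adjoint_formEmbed_oneSubLap (φ : Test n) :
    ContinuousLinearMap.adjoint (formEmbed n) (toL2 (oneSubLap n φ)) = ⟨jet φ, jet_mem φ⟩ := by
  rw [← sub_eq_zero]
  refine formDomain_eq_zero _ fun ψ => ?_
  rw [Submodule.coe_sub, inner_sub_right, inner_jet, sub_eq_zero]
  exact ContinuousLinearMap.adjoint_inner_right (formEmbed n) ⟨jet ψ, jet_mem ψ⟩ _

theorem resolvent_oneSubLap (φ : Test n) :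
    subLaplacianResolvent n (toL2 (oneSubLap n φ)) = toL2 φ := by
  change formEmbed n (ContinuousLinearMap.adjoint (formEmbed n) _) = _
  rw [adjoint_formEmbed_oneSubLap]
  rfl

theorem resolvent_isPositive : (subLaplacianResolvent n).IsPositive :=
  (formEmbed n).isPositive_self_comp_adjoint

theorem norm_formEmbed_le : ‖formEmbed n‖ ≤ 1 := by
  refine ContinuousLinearMap.opNorm_le_bound _ zero_le_one fun v => ?_
  rw [one_mul]
  exact PiLp.norm_apply_le (v : JetSpace n) none

theorem norm_resolvent_le : ‖subLaplacianResolvent n‖ ≤ 1 := by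
  refine (ContinuousLinearMap.opNorm_comp_le _ _).trans ?_
  rw [LinearIsometryEquiv.norm_map]
  have h := norm_formEmbed_le (n := n)
  have h0 : 0 ≤ ‖formEmbed n‖ := ContinuousLinearMap.opNorm_nonneg _
  nlinarith

theorem resolvent_injective (g : L2 n) (h : subLaplacianResolvent n g = 0) : g = 0 := by
  have h1 : ContinuousLinearMap.adjoint (formEmbed n) g = 0 := by
    rw [← inner_self_eq_zero (𝕜 := ℂ), ContinuousLinearMap.adjoint_inner_right]
    change inner ℂ (subLaplacianResolvent n g) g = 0
    rw [h, inner_zero_left]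
  refine eq_zero_of_inner_toL2 g fun φ => ?_
  have h2 : toL2 φ = formEmbed n ⟨jet φ, jet_mem φ⟩ := rfl
  rw [h2, ← ContinuousLinearMap.adjoint_inner_right, h1, inner_zero_right]

/-! ### Distributions defined by square-integrable functions -/

theorem continuous_D_ofSupportedIn (e : Space n) {K : Compacts (Space n)}
    (hK : (K : Set (Space n)) ⊆ ((⊤ : Opens (Space n)) : Set (Space n))) :
    Continuous fun φ : ContDiffMapSupportedIn (Space n) ℝ ⊤ K =>
      D e (TestFunction.ofSupportedIn hK φ) := by
  let T : ContDiffMapSupportedIn (Space n) ℝ ⊤ K →L[ℝ] ContDiffMapSupportedIn (Space n) ℝ ⊤ K :=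
    (ContDiffMapSupportedIn.bilinLeftCLM (ContinuousLinearMap.id ℝ (Space n →L[ℝ] ℝ))
      (contDiff_leftField e)) ∘L (ContDiffMapSupportedIn.fderivCLM ℝ ⊤ ⊤)
  have h : (fun φ : ContDiffMapSupportedIn (Space n) ℝ ⊤ K =>
      D e (TestFunction.ofSupportedIn hK φ)) = fun φ => TestFunction.ofSupportedIn hK (T φ) := by
    funext φ
    ext z
    simp only [D_apply, T]
    change _ = (ContDiffMapSupportedIn.fderivCLM ℝ ⊤ ⊤ φ) z (leftField e z)
    rw [ContDiffMapSupportedIn.fderivCLM_apply_of_le ℝ φ (by simp)]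
    rfl
  rw [h]
  exact (TestFunction.continuous_ofSupportedIn hK).comp T.continuous

theorem continuous_D (e : Space n) : Continuous (D e) := by
  rw [TestFunction.continuous_iff_continuous_comp (D e)]
  intro K hK
  exact continuous_D_ofSupportedIn e hK

theorem continuous_oneSubLap : Continuous (oneSubLap n) := by
  have h : (oneSubLap n : Test n → Test n) = fun φ => φ -
      ∑ j, (D (EuclideanSpace.single j 1, 0, 0) (D (EuclideanSpace.single j 1, 0, 0) φ)
        + D (0, EuclideanSpace.single j 1, 0) (D (0, EuclideanSpace.single j 1, 0) φ)) := by
    funext φ; simp [oneSubLap, lap, LinearMap.sum_apply]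
  rw [h]
  refine continuous_id.sub (continuous_finsetSum _ fun j _ => ?_)
  exact ((continuous_D _).comp (continuous_D _)).add ((continuous_D _).comp (continuous_D _))

theorem continuous_pairL2 (g : L2 n) : Continuous (pairL2 g) := by
  have h := (TestFunction.integralAgainstBilinCLM (𝕜 := ℝ) (Ω := (⊤ : Opens (Space n))) (n := ⊤)
    (ContinuousLinearMap.lsmul ℝ ℝ : ℝ →L[ℝ] ℂ →L[ℝ] ℂ) volume (g : Space n → ℂ)).continuous
  refine h.congr fun φ => ?_
  rw [TestFunction.integralAgainstBilinCLM_eq_integral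
    ((locallyIntegrable_L2 g).locallyIntegrableOn _)]
  rfl

/-! ### A Liouville property of `I - 𝓛` -/

/-- Functionals on test functions whose pairing with the right translates of a fixed test function
is a continuous function of polynomial growth, differentiable along one-parameter subgroups. -/
structure Tame (f : Test n →ₗ[ℝ] ℂ) : Prop where
  hasDerivAt : ∀ e φ, HasDerivAt (fun t : ℝ => f (translate (t • e) φ)) (f (D e φ)) 0
  continuous : ∀ φ, Continuous fun x => f (translate x φ)
  growth : ∀ φ, ∃ (C : ℝ) (N : ℕ), 0 ≤ C ∧ ∀ x, ‖f (translate x φ)‖ ≤ C * (1 + ‖x‖) ^ N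

theorem tame_pairL2 (g : L2 n) : Tame (pairL2 g) where
  hasDerivAt e φ := hasDerivAt_pairing_translate (locallyIntegrable_L2 g) e φ
  continuous φ := continuous_pairing_translate (locallyIntegrable_L2 g) φ
  growth φ := by
    refine ⟨‖toL2 φ‖ * ‖g‖, 0, by positivity, fun x => ?_⟩
    rw [pairL2_apply, pow_zero, mul_one, ← norm_toL2_translate x φ]
    exact norm_inner_le_norm _ _

theorem Tame.add {f f' : Test n →ₗ[ℝ] ℂ} (hf : Tame f) (hf' : Tame f') : Tame (f + f') where
  hasDerivAt e φ := (hf.hasDerivAt e φ).add (hf'.hasDerivAt e φ)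
  continuous φ := (hf.continuous φ).add (hf'.continuous φ)
  growth φ := by
    obtain ⟨C, N, hC, h⟩ := hf.growth φ
    obtain ⟨C', N', hC', h'⟩ := hf'.growth φ
    refine ⟨C + C', max N N', by positivity, fun x => ?_⟩
    have h1 : (1 : ℝ) ≤ 1 + ‖x‖ := by linarith [norm_nonneg x]
    calc ‖f (translate x φ) + f' (translate x φ)‖
        ≤ C * (1 + ‖x‖) ^ N + C' * (1 + ‖x‖) ^ N' :=
          (norm_add_le _ _).trans (add_le_add (h x) (h' x))
      _ ≤ C * (1 + ‖x‖) ^ max N N' + C' * (1 + ‖x‖) ^ max N N' := by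
          gcongr
          · exact le_max_left _ _
          · exact le_max_right _ _
      _ = _ := by ring

theorem Tame.neg {f : Test n →ₗ[ℝ] ℂ} (hf : Tame f) : Tame (-f) where
  hasDerivAt e φ := (hf.hasDerivAt e φ).neg
  continuous φ := (hf.continuous φ).neg
  growth φ := by
    obtain ⟨C, N, hC, h⟩ := hf.growth φ
    exact ⟨C, N, hC, fun x => by simpa using h x⟩

theorem tame_zero : Tame (0 : Test n →ₗ[ℝ] ℂ) where
  hasDerivAt e φ := by simpa using hasDerivAt_const (0 : ℝ) (0 : ℂ)
  continuous φ := by simpa using continuous_const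
  growth φ := ⟨0, 0, le_rfl, fun x => by simp⟩

theorem Tame.sum {ι : Type*} (s : Finset ι) {f : ι → Test n →ₗ[ℝ] ℂ} (hf : ∀ i ∈ s, Tame (f i)) :
    Tame (∑ i ∈ s, f i) :=
  Finset.sum_induction f Tame (fun _ _ h h' => h.add h') tame_zero hf

theorem abs_symp_le (e x : Space n) : |symp e x| ≤ 2 * ‖e‖ * ‖x‖ := by
  have h1 : |inner ℝ e.1 x.2.1| ≤ ‖e‖ * ‖x‖ := (abs_real_inner_le_norm _ _).trans <|
    mul_le_mul (norm_fst_le e) ((norm_fst_le x.2).trans (norm_snd_le x)) (norm_nonneg _)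
      (norm_nonneg _)
  have h2 : |inner ℝ x.1 e.2.1| ≤ ‖x‖ * ‖e‖ := (abs_real_inner_le_norm _ _).trans <|
    mul_le_mul (norm_fst_le x) ((norm_fst_le e.2).trans (norm_snd_le e)) (norm_nonneg _)
      (norm_nonneg _)
  calc |symp e x| ≤ |inner ℝ e.1 x.2.1| + |inner ℝ x.1 e.2.1| := abs_sub _ _
    _ ≤ 2 * ‖e‖ * ‖x‖ := by linarith

theorem Tame.comp_D {f : Test n →ₗ[ℝ] ℂ} (hf : Tame f) (e' : Space n) : Tame (f ∘ₗ D e') where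
  hasDerivAt e φ := by
    have h1 := (hf.hasDerivAt e (D e' φ)).add
      (((hasDerivAt_id (0 : ℝ)).mul_const (symp e' e)).smul (hf.hasDerivAt e (D center φ)))
    -- the derivative produced by the product rule differs from `f (D e' (D e φ))` by a commutator
    have h2 : f (D e' (D e φ)) = f (D e (D e' φ)) + symp e' e • f (D center φ) := by
      rw [← map_smul, ← map_add, ← D_commutator]; congr 1; abel
    refine (h1.congr_deriv ?_).congr_of_eventuallyEq (Eventually.of_forall fun t => ?_)
    · rw [LinearMap.comp_apply, h2, zero_smul, translate_zero, one_mul]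
      simp
    · change f (D e' (translate (t • e) φ)) = f (translate (t • e) (D e' φ))
        + (t * symp e' e) • f (translate (t • e) (D center φ))
      rw [D_translate, symp_smul_right, map_add, map_smul]
  continuous φ := by
    have hs : Continuous fun x : Space n => symp e' x := by unfold symp; fun_prop
    refine ((hf.continuous (D e' φ)).add (hs.smul (hf.continuous (D center φ)))).congr fun x => ?_
    rw [LinearMap.comp_apply, D_translate, map_add, map_smul]
    rfl
  growth φ := by
    obtain ⟨C, N, hC, h⟩ := hf.growth (D e' φ)
    obtain ⟨C', N', hC', h'⟩ := hf.growth (D center φ)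
    refine ⟨C + 2 * ‖e'‖ * C', max N (N' + 1), by positivity, fun x => ?_⟩
    have h1 : (1 : ℝ) ≤ 1 + ‖x‖ := by linarith [norm_nonneg x]
    have h3 : ‖symp e' x‖ ≤ 2 * ‖e'‖ * (1 + ‖x‖) := (abs_symp_le e' x).trans (by gcongr; linarith)
    calc ‖(f ∘ₗ D e') (translate x φ)‖
        = ‖f (translate x (D e' φ)) + symp e' x • f (translate x (D center φ))‖ := by
          simp [D_translate]
      _ ≤ C * (1 + ‖x‖) ^ N + 2 * ‖e'‖ * (1 + ‖x‖) * (C' * (1 + ‖x‖) ^ N') := by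
          refine (norm_add_le _ _).trans (add_le_add (h x) ?_)
          rw [norm_smul]
          exact mul_le_mul h3 (h' x) (norm_nonneg _) (by positivity)
      _ = C * (1 + ‖x‖) ^ N + 2 * ‖e'‖ * C' * (1 + ‖x‖) ^ (N' + 1) := by ring
      _ ≤ C * (1 + ‖x‖) ^ max N (N' + 1) + 2 * ‖e'‖ * C' * (1 + ‖x‖) ^ max N (N' + 1) := by
          gcongr
          · exact le_max_left _ _
          · exact le_max_right _ _
      _ = _ := by ring

theorem Tame.comp_oneSubLap {f : Test n →ₗ[ℝ] ℂ} (hf : Tame f) : Tame (f ∘ₗ oneSubLap n) := by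
  have h : f ∘ₗ oneSubLap n = f + -∑ j,
      ((f ∘ₗ D (EuclideanSpace.single j 1, 0, 0)) ∘ₗ D (EuclideanSpace.single j 1, 0, 0)
      + (f ∘ₗ D (0, EuclideanSpace.single j 1, 0)) ∘ₗ D (0, EuclideanSpace.single j 1, 0)) := by
    ext φ
    simp [oneSubLap, lap, LinearMap.sum_apply, sub_eq_add_neg]
  rw [h]
  exact hf.add (Tame.neg (Tame.sum _ fun j _ =>
    ((hf.comp_D _).comp_D _).add ((hf.comp_D _).comp_D _)))

theorem smul_mul_smul' (e : Space n) (s t : ℝ) : mul (s • e) (t • e) = (s + t) • e := by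
  rw [mul_smul_eq, add_smul]
  congr 2
  refine Prod.ext rfl (Prod.ext rfl ?_)
  simp [leftField, symp_smul_left, symp_self]

/-- Differentiability at `0` propagates along a one-parameter subgroup. -/
theorem Tame.hasDerivAt_at {f : Test n →ₗ[ℝ] ℂ} (hf : Tame f) (e : Space n) (φ : Test n) (t : ℝ) :
    HasDerivAt (fun t : ℝ => f (translate (t • e) φ)) (f (translate (t • e) (D e φ))) t := by
  have h := hf.hasDerivAt e (translate (t • e) φ)
  rw [D_translate, symp_smul_right, symp_self, mul_zero, zero_smul, add_zero] at h
  simp only [translate_translate, smul_mul_smul'] at h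
  have h2 := HasDerivAt.comp_sub_const t t (by simpa using h)
  simpa using h2

/-- The second derivative test, in the form of a necessary condition for a local maximum. -/
theorem second_deriv_nonpos_of_isLocalMax {f f' : ℝ → ℝ} {c x : ℝ} (h : ∀ t, HasDerivAt f (f' t) t)
    (h' : HasDerivAt f' c x) (hm : IsLocalMax f x) : c ≤ 0 := by
  by_contra! hc
  have hd : deriv f = f' := funext fun t => (h t).deriv
  have hmin : IsLocalMin f x :=
    isLocalMin_of_deriv_deriv_pos (by rw [hd, h'.deriv]; exact hc) hm.deriv_eq_zero
      (h x).continuousAt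
  have hconst : f =ᶠ[𝓝 x] fun _ => f x := by
    filter_upwards [hm, hmin] with y h1 h2 using le_antisymm h1 h2
  have h2 : deriv (deriv f) x = 0 := by
    rw [hconst.deriv.deriv_eq]; simp
  rw [hd, h'.deriv] at h2
  exact hc.ne' h2

/-- The square of the Euclidean norm of the horizontal part. -/
def horSq (x : Space n) : ℝ := ‖x.1‖ ^ 2 + ‖x.2.1‖ ^ 2

/-- The proper function `M + (|x|² + |y|²)² + τ²`. -/
def gauge (M : ℝ) (x : Space n) : ℝ := M + horSq x ^ 2 + x.2.2 ^ 2

theorem continuous_gauge (M : ℝ) : Continuous (gauge M : Space n → ℝ) := by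
  unfold gauge horSq; fun_prop

theorem horSq_nonneg (x : Space n) : 0 ≤ horSq x := by unfold horSq; positivity

theorem norm_sq_le_gauge {M : ℝ} (hM : 1 ≤ M) (x : Space n) : ‖x‖ ^ 2 ≤ gauge M x := by
  have h1 : ‖x.1‖ ^ 2 ≤ gauge M x := by
    unfold gauge horSq
    nlinarith [sq_nonneg (‖x.1‖ ^ 2 + ‖x.2.1‖ ^ 2 - 1), sq_nonneg x.2.2, sq_nonneg ‖x.1‖,
      sq_nonneg ‖x.2.1‖]
  have h2 : ‖x.2.1‖ ^ 2 ≤ gauge M x := by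
    unfold gauge horSq
    nlinarith [sq_nonneg (‖x.1‖ ^ 2 + ‖x.2.1‖ ^ 2 - 1), sq_nonneg x.2.2, sq_nonneg ‖x.1‖,
      sq_nonneg ‖x.2.1‖]
  have h3 : ‖x.2.2‖ ^ 2 ≤ gauge M x := by
    unfold gauge
    rw [Real.norm_eq_abs, sq_abs]
    nlinarith [sq_nonneg (horSq x)]
  rcases max_choice ‖x.1‖ ‖x.2‖ with h | h
  · rw [Prod.norm_def, h]; exact h1
  · rw [Prod.norm_def, h]
    rcases max_choice ‖x.2.1‖ ‖x.2.2‖ with h | h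
    · rw [Prod.norm_def, h]; exact h2
    · rw [Prod.norm_def, h]; exact h3

theorem isCompact_gauge_le {M : ℝ} (hM : 1 ≤ M) (B : ℝ) :
    IsCompact {x : Space n | gauge M x ≤ B} := by
  refine Metric.isCompact_of_isClosed_isBounded
    (isClosed_le (continuous_gauge M) continuous_const) ?_
  refine (Metric.isBounded_closedBall (x := (0 : Space n)) (r := 1 + B)).subset fun x hx => ?_
  rw [mem_closedBall_zero_iff]
  have h1 := norm_sq_le_gauge hM x
  have h2 : gauge M x ≤ B := hx
  nlinarith [sq_nonneg (‖x‖ - 1), norm_nonneg x]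

theorem gauge_mul_X (M t : ℝ) (j : Fin n) (x : Space n) :
    gauge M (mul (t • (EuclideanSpace.single j 1, 0, 0)) x)
      = M + (horSq x + 2 * t * x.1 j + t ^ 2) ^ 2 + (x.2.2 + t * x.2.1 j / 2) ^ 2 := by
  have h1 : ‖t • EuclideanSpace.single j (1 : ℝ) + x.1‖ ^ 2
      = ‖x.1‖ ^ 2 + 2 * t * x.1 j + t ^ 2 := by
    rw [norm_add_sq_real, norm_smul, real_inner_smul_left, EuclideanSpace.inner_single_left,
      PiLp.norm_single]
    simp; ring
  have h2 : symp (t • ((EuclideanSpace.single j 1, 0, 0) : Space n)) x = t * x.2.1 j := by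
    rw [symp_smul_left]
    simp [symp, EuclideanSpace.inner_single_left]
  simp only [gauge, horSq, mul, h2]
  simp only [Prod.smul_fst, Prod.smul_snd, h1, smul_zero, zero_add]
  ring

theorem gauge_mul_Y (M t : ℝ) (j : Fin n) (x : Space n) :
    gauge M (mul (t • (0, EuclideanSpace.single j 1, 0)) x)
      = M + (horSq x + 2 * t * x.2.1 j + t ^ 2) ^ 2 + (x.2.2 + t * (-x.1 j) / 2) ^ 2 := by
  have h1 : ‖t • EuclideanSpace.single j (1 : ℝ) + x.2.1‖ ^ 2
      = ‖x.2.1‖ ^ 2 + 2 * t * x.2.1 j + t ^ 2 := by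
    rw [norm_add_sq_real, norm_smul, real_inner_smul_left, EuclideanSpace.inner_single_left,
      PiLp.norm_single]
    simp; ring
  have h2 : symp (t • ((0, EuclideanSpace.single j 1, 0) : Space n)) x = t * (-x.1 j) := by
    rw [symp_smul_left]
    simp [symp, EuclideanSpace.inner_single_right]
  simp only [gauge, horSq, mul, h2]
  simp only [Prod.smul_fst, Prod.smul_snd, h1, smul_zero, zero_add]
  ring

/-- Derivatives of a power of the gauge along the line `t ↦ (t e) ∘ x`, for horizontal `e`. -/
theorem hasDerivAt_gauge_pow (M q a τ b : ℝ) (N : ℕ) :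
    let Q : ℝ → ℝ := fun t => M + (q + 2 * t * a + t ^ 2) ^ 2 + (τ + t * b / 2) ^ 2
    let Q' : ℝ → ℝ := fun t => 2 * (q + 2 * t * a + t ^ 2) * (2 * a + 2 * t) + (τ + t * b / 2) * b
    (∀ t, HasDerivAt (fun t => Q t ^ (N + 2)) ((N + 2) * Q t ^ (N + 1) * Q' t) t) ∧
    HasDerivAt (fun t => (N + 2) * Q t ^ (N + 1) * Q' t)
      ((N + 2) * (N + 1) * (M + q ^ 2 + τ ^ 2) ^ N * (4 * q * a + τ * b) ^ 2
        + (N + 2) * (M + q ^ 2 + τ ^ 2) ^ (N + 1) * (8 * a ^ 2 + 4 * q + b ^ 2 / 2)) 0 := by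
  intro Q Q'
  have hA : ∀ t : ℝ, HasDerivAt (fun t : ℝ => q + 2 * t * a + t ^ 2) (2 * a + 2 * t) t :=
      fun t => by
    exact (((((hasDerivAt_id t).const_mul 2).mul_const a).const_add q).add
      (hasDerivAt_pow 2 t)).congr_deriv (by simp)
  have hB : ∀ t : ℝ, HasDerivAt (fun t : ℝ => τ + t * b / 2) (b / 2) t := fun t => by
    have := (((hasDerivAt_id t).mul_const b).div_const 2).const_add τ
    simpa using this
  have hQ : ∀ t, HasDerivAt Q (Q' t) t := fun t => by
    have := (((hA t).pow 2).const_add M).add ((hB t).pow 2)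
    exact this.congr_deriv (by simp only [Q']; push_cast; ring)
  have hQ' : HasDerivAt Q' (8 * a ^ 2 + 4 * q + b ^ 2 / 2) 0 := by
    have h1 : HasDerivAt (fun t : ℝ => 2 * a + 2 * t) 2 0 := by
      simpa using ((hasDerivAt_id (0 : ℝ)).const_mul 2).const_add (2 * a)
    have := (((hA 0).const_mul 2).mul h1).add ((hB 0).mul_const b)
    exact this.congr_deriv (by ring)
  refine ⟨fun t => ?_, ?_⟩
  · have := (hQ t).pow (N + 2)
    exact this.congr_deriv (by push_cast; rfl)
  · have h0 : Q 0 = M + q ^ 2 + τ ^ 2 := by simp [Q]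
    have h0' : Q' 0 = 4 * q * a + τ * b := by simp only [Q']; ring
    have := (((hQ 0).pow (N + 1)).const_mul ((N : ℝ) + 2)).mul hQ'
    refine this.congr_deriv ?_
    simp only [Pi.pow_apply, h0, h0', Nat.add_sub_cancel]
    push_cast; ring

/-- A high power of the gauge is a strict supersolution of `I - 𝓛` if `M` is large. -/
theorem sum_gauge_le (N : ℕ) {M : ℝ} (x : Space n)
    (hM : (((N : ℝ) + 2) * (16 * (N + 1) + 8 * n + 9)) ^ 2 ≤ M) :
    ∑ j, ((((N : ℝ) + 2) * (N + 1) * gauge M x ^ N * (4 * horSq x * x.1 j + x.2.2 * x.2.1 j) ^ 2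
        + (N + 2) * gauge M x ^ (N + 1) * (8 * x.1 j ^ 2 + 4 * horSq x + x.2.1 j ^ 2 / 2))
      + ((N + 2) * (N + 1) * gauge M x ^ N * (4 * horSq x * x.2.1 j + x.2.2 * (-x.1 j)) ^ 2
        + (N + 2) * gauge M x ^ (N + 1) * (8 * x.2.1 j ^ 2 + 4 * horSq x + (-x.1 j) ^ 2 / 2)))
      ≤ gauge M x ^ (N + 2) := by
  set q := horSq x with hq
  set Q := gauge M x with hQ
  have hq0 : 0 ≤ q := horSq_nonneg x
  have hsum : ∑ j, (x.1 j ^ 2 + x.2.1 j ^ 2) = q := by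
    rw [Finset.sum_add_distrib, hq, horSq, EuclideanSpace.norm_sq_eq, EuclideanSpace.norm_sq_eq]
    simp
  set κ := ((N : ℝ) + 2) * (16 * (N + 1) + 8 * n + 9) with hκ
  have hκ0 : 0 ≤ κ := by positivity
  have hQv : Q = M + q ^ 2 + x.2.2 ^ 2 := rfl
  have hκq : κ * q ≤ Q := by
    rw [hQv]; nlinarith [sq_nonneg (κ - q), sq_nonneg x.2.2, mul_nonneg hκ0 hq0]
  have hQ0 : 0 ≤ Q := (mul_nonneg hκ0 hq0).trans hκq
  have hq2 : 16 * q ^ 2 + x.2.2 ^ 2 ≤ 16 * Q := by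
    rw [hQv]; nlinarith [sq_nonneg x.2.2, sq_nonneg κ]
  calc _ = ∑ j : Fin n, ((((N : ℝ) + 2) * (N + 1) * Q ^ N * (16 * q ^ 2 + x.2.2 ^ 2)
          + (N + 2) * Q ^ (N + 1) * (17 / 2)) * (x.1 j ^ 2 + x.2.1 j ^ 2)
          + (N + 2) * Q ^ (N + 1) * (8 * q)) := by
        refine Finset.sum_congr rfl fun j _ => ?_
        ring
    _ = (((N : ℝ) + 2) * (N + 1) * Q ^ N * (16 * q ^ 2 + x.2.2 ^ 2)
          + (N + 2) * Q ^ (N + 1) * (17 / 2)) * q + n * ((N + 2) * Q ^ (N + 1) * (8 * q)) := by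
        rw [Finset.sum_add_distrib, ← Finset.mul_sum, hsum]
        simp
    _ ≤ (((N : ℝ) + 2) * (N + 1) * Q ^ N * (16 * Q)
          + (N + 2) * Q ^ (N + 1) * 9) * q + n * ((N + 2) * Q ^ (N + 1) * (8 * q)) := by
        gcongr
        norm_num
    _ = Q ^ (N + 1) * (κ * q) := by rw [hκ]; ring
    _ ≤ Q ^ (N + 1) * Q := by gcongr
    _ = Q ^ (N + 2) := by ring

/-- The maximum principle: the translates of `f`, minus a small multiple of a supersolution that
grows faster, have a maximum, at which the second derivative test applies. -/
theorem Tame.re_nonpos {f : Test n →ₗ[ℝ] ℂ} (hf : Tame f) (h0 : ∀ φ, f (oneSubLap n φ) = 0)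
    (c : ℂ) (φ : Test n) : (c * f φ).re ≤ 0 := by
  obtain ⟨C, N, hC, hg⟩ := hf.growth φ
  set M : ℝ := (((N : ℝ) + 2) * (16 * (N + 1) + 8 * n + 9)) ^ 2 with hM
  have hM1 : 1 ≤ M := by
    rw [hM]
    have : (1 : ℝ) ≤ ((N : ℝ) + 2) * (16 * (N + 1) + 8 * n + 9) := by
      have hN : (0 : ℝ) ≤ N := N.cast_nonneg
      have hn : (0 : ℝ) ≤ n := n.cast_nonneg
      nlinarith [mul_nonneg hN hn]
    exact one_le_pow₀ this
  set h : Space n → ℝ := fun x => (c * f (translate x φ)).re with hh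
  have hhc : Continuous h := Complex.continuous_re.comp (continuous_const.mul (hf.continuous φ))
  have hQ1 : ∀ x : Space n, 1 ≤ gauge M x := fun x => by
    unfold gauge; nlinarith [sq_nonneg (horSq x), sq_nonneg x.2.2]
  set B : ℝ := ‖c‖ * C * 4 ^ N with hB
  have hB0 : 0 ≤ B := by positivity
  have hgrow : ∀ x, h x ≤ B * gauge M x ^ N := fun x => by
    have h1 : 1 + ‖x‖ ≤ 4 * gauge M x := by
      nlinarith [norm_sq_le_gauge hM1 x, hQ1 x, sq_nonneg (‖x‖ - 1)]
    calc h x ≤ ‖c * f (translate x φ)‖ := Complex.re_le_norm _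
      _ ≤ ‖c‖ * (C * (1 + ‖x‖) ^ N) := by
          rw [norm_mul]; exact mul_le_mul_of_nonneg_left (hg x) (norm_nonneg _)
      _ ≤ ‖c‖ * (C * (4 * gauge M x) ^ N) := by gcongr
      _ = B * gauge M x ^ N := by rw [hB, mul_pow]; ring
  suffices key : ∀ ε > 0, h 0 ≤ ε * gauge M (0 : Space n) ^ (N + 2) by
    have : h 0 ≤ 0 := by
      have hlim : Tendsto (fun ε : ℝ => ε * gauge M (0 : Space n) ^ (N + 2)) (𝓝[>] 0) (𝓝 0) := by
        have : Tendsto (fun ε : ℝ => ε * gauge M (0 : Space n) ^ (N + 2)) (𝓝 0) (𝓝 (0 * _)) :=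
          (continuous_id.mul continuous_const).tendsto 0
        rw [zero_mul] at this
        exact this.mono_left nhdsWithin_le_nhds
      exact ge_of_tendsto hlim (eventually_mem_nhdsWithin.mono fun ε hε => key ε hε)
    simpa [hh, translate_zero] using this
  intro ε hε
  by_contra! hpos
  set u : Space n → ℝ := fun x => h x - ε * gauge M x ^ (N + 2) with hu
  have huc : Continuous u := hhc.sub (continuous_const.mul ((continuous_gauge M).pow _))
  have hu0 : 0 < u 0 := sub_pos.2 hpos
  have hout : ∀ x, 0 < u x → gauge M x ≤ B / ε := fun x hx => by
    have h1 : ε * gauge M x ^ (N + 2) < B * gauge M x ^ N := (sub_pos.1 hx).trans_le (hgrow x)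
    have h2 : 0 < gauge M x ^ N := pow_pos (by linarith [hQ1 x]) N
    have h3 : ε * gauge M x ^ 2 < B := by
      refine lt_of_mul_lt_mul_right ?_ h2.le
      calc _ = ε * gauge M x ^ (N + 2) := by ring
        _ < _ := h1
    rw [le_div_iff₀ hε]
    nlinarith [hQ1 x]
  obtain ⟨x₀, hx₀, hmax⟩ := (isCompact_gauge_le hM1 (B / ε)).exists_isMaxOn
    ⟨0, hout 0 hu0⟩ huc.continuousOn
  have hux₀ : 0 < u x₀ := hu0.trans_le (hmax (hout 0 hu0))
  have hglob : ∀ x, u x ≤ u x₀ := fun x => by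
    by_cases hx : 0 < u x
    · exact hmax (hout x hx)
    · linarith
  set ψ := translate x₀ φ with hψ
  -- the second derivative test at the maximum, along the line `t ↦ (t e) ∘ x₀`
  have hsecond : ∀ (e : Space n) (a b : ℝ),
      (∀ t : ℝ, gauge M (mul (t • e) x₀)
        = M + (horSq x₀ + 2 * t * a + t ^ 2) ^ 2 + (x₀.2.2 + t * b / 2) ^ 2) →
      (c * f (D e (D e ψ))).re ≤ ε * (((N : ℝ) + 2) * (N + 1) * gauge M x₀ ^ N
        * (4 * horSq x₀ * a + x₀.2.2 * b) ^ 2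
        + (N + 2) * gauge M x₀ ^ (N + 1) * (8 * a ^ 2 + 4 * horSq x₀ + b ^ 2 / 2)) := by
    intro e a b hab
    obtain ⟨hw1, hw2⟩ := hasDerivAt_gauge_pow M (horSq x₀) a x₀.2.2 b N
    have hre : ∀ (χ : Test n) (t : ℝ), HasDerivAt (fun t : ℝ => (c * f (translate (t • e) χ)).re)
        (c * f (translate (t • e) (D e χ))).re t := fun χ t =>
      (Complex.reCLM.hasFDerivAt.comp_hasDerivAt t ((hf.hasDerivAt_at e χ t).const_mul c))
    have h1 := fun t => (hre ψ t).sub ((hw1 t).const_mul ε)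
    have h2 := (hre (D e ψ) 0).sub (hw2.const_mul ε)
    have hmx : IsLocalMax (fun t : ℝ => (c * f (translate (t • e) ψ)).re
        - ε * (M + (horSq x₀ + 2 * t * a + t ^ 2) ^ 2 + (x₀.2.2 + t * b / 2) ^ 2) ^ (N + 2)) 0 := by
      refine Eventually.of_forall fun t => ?_
      have hut : ∀ t : ℝ, u (mul (t • e) x₀) = (c * f (translate (t • e) ψ)).re
          - ε * (M + (horSq x₀ + 2 * t * a + t ^ 2) ^ 2 + (x₀.2.2 + t * b / 2) ^ 2) ^ (N + 2) := by
        intro t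
        simp only [hu, hh, hψ, translate_translate, hab]
      simp only [← hut]
      rw [zero_smul, zero_mul']
      exact hglob _
    have := second_deriv_nonpos_of_isLocalMax h1 h2 hmx
    rw [zero_smul, translate_zero] at this
    exact sub_nonpos.1 this
  have hlap : h x₀ = ∑ j, ((c * f (D (EuclideanSpace.single j 1, 0, 0)
      (D (EuclideanSpace.single j 1, 0, 0) ψ))).re
      + (c * f (D (0, EuclideanSpace.single j 1, 0)
        (D (0, EuclideanSpace.single j 1, 0) ψ))).re) := by
    have h1 : f ψ = f (lap n ψ) := by
      have := h0 ψ
      rw [oneSubLap, LinearMap.sub_apply, map_sub, sub_eq_zero] at this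
      exact this
    have h2 : h x₀ = (c * f ψ).re := rfl
    rw [h2, h1, lap, LinearMap.sum_apply, map_sum, Finset.mul_sum, Complex.re_sum]
    refine Finset.sum_congr rfl fun j _ => ?_
    simp [mul_add]
  have hle : h x₀ ≤ ε * gauge M x₀ ^ (N + 2) := by
    rw [hlap]
    refine le_trans ?_ (mul_le_mul_of_nonneg_left (sum_gauge_le N x₀ hM.symm.le) hε.le)
    rw [Finset.mul_sum]
    refine Finset.sum_le_sum fun j _ => ?_
    rw [mul_add]
    exact add_le_add (hsecond _ _ _ fun t => gauge_mul_X M t j x₀)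
      (hsecond _ _ _ fun t => gauge_mul_Y M t j x₀)
  exact absurd hux₀ (not_lt.2 (sub_nonpos.2 hle))

theorem Tame.eq_zero {f : Test n →ₗ[ℝ] ℂ} (hf : Tame f) (h0 : ∀ φ, f (oneSubLap n φ) = 0)
    (φ : Test n) : f φ = 0 := by
  have h := hf.re_nonpos h0 (starRingEnd ℂ (f φ)) φ
  rw [← Complex.normSq_eq_conj_mul_self, Complex.ofReal_re] at h
  exact Complex.normSq_eq_zero.1 (le_antisymm h (Complex.normSq_nonneg _))

/-- The range of `(I - 𝓛)^k` on test functions is total in `L²`. -/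
theorem eq_zero_of_inner_oneSubLap_iterate (k : ℕ) (g : L2 n)
    (h : ∀ φ : Test n, inner ℂ (toL2 ((oneSubLap n)^[k] φ)) g = 0) : g = 0 := by
  have ht : ∀ k : ℕ, Tame (pairL2 g ∘ₗ (oneSubLap n) ^ k) := fun k => by
    induction k with
    | zero => exact tame_pairL2 g
    | succ k ih => rw [pow_succ]; exact ih.comp_oneSubLap
  induction k with
  | zero => exact eq_zero_of_inner_toL2 g h
  | succ k ih =>
    refine ih fun φ => ?_
    have := (ht k).eq_zero (fun φ => ?_) φ
    · simpa [Module.End.pow_apply, pairL2_apply] using this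
    · have := h φ
      rw [Function.iterate_succ_apply] at this
      simpa [Module.End.pow_apply, pairL2_apply] using this

end

/-! ### Powers of a positive contraction -/

theorem injective_pow {H : Type*} [NormedAddCommGroup H] [NormedSpace ℂ H] {R : H →L[ℂ] H}
    (hinj : ∀ x, R x = 0 → x = 0) (k : ℕ) (x : H) (hx : (R ^ k) x = 0) : x = 0 := by
  induction k with
  | zero => simpa using hx
  | succ k ih => exact ih (hinj _ (by rw [pow_succ'] at hx; exact hx))

section Powers

variable {H : Type*} [NormedAddCommGroup H] [InnerProductSpace ℂ H] [CompleteSpace H]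
  {R : H →L[ℂ] H}

theorem continuousOn_rpow_spectrum {a : ℝ} (ha : 0 ≤ a) (s : Set ℝ) :
    ContinuousOn (fun r : ℝ => r ^ a) s :=
  (Real.continuous_rpow_const ha).continuousOn

theorem spectrum_nonneg_of_isPositive (hR : R.IsPositive) {r : ℝ} (hr : r ∈ spectrum ℝ R) : 0 ≤ r :=
  spectrum_nonneg_of_nonneg (ContinuousLinearMap.nonneg_iff_isPositive R |>.2 hR) hr

theorem opPow_zero (hR : R.IsPositive) : opPow R 0 = 1 := by
  have := hR.isSelfAdjoint
  simp only [opPow, Real.rpow_zero]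
  exact cfc_const_one ℝ R

theorem opPow_one (hR : R.IsPositive) : opPow R 1 = R := by
  have := hR.isSelfAdjoint
  simp only [opPow, Real.rpow_one]
  exact cfc_id' ℝ R

theorem opPow_mul_opPow (hR : R.IsPositive) {a b : ℝ} (ha : 0 ≤ a) (hb : 0 ≤ b) :
    opPow R a * opPow R b = opPow R (a + b) := by
  rw [opPow, opPow, opPow, ← cfc_mul _ _ R (continuousOn_rpow_spectrum ha _)
    (continuousOn_rpow_spectrum hb _)]
  refine cfc_congr fun r hr => ?_
  exact (Real.rpow_add_of_nonneg (spectrum_nonneg_of_isPositive hR hr) ha hb).symm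

theorem opPow_opPow_apply (hR : R.IsPositive) {a b : ℝ} (ha : 0 ≤ a) (hb : 0 ≤ b) (x : H) :
    opPow R a (opPow R b x) = opPow R (a + b) x := by
  rw [← opPow_mul_opPow hR ha hb]; rfl

theorem opPow_natCast (hR : R.IsPositive) (k : ℕ) : opPow R k = R ^ k := by
  induction k with
  | zero => simpa using opPow_zero hR
  | succ k ih =>
    rw [Nat.cast_succ, ← opPow_mul_opPow hR k.cast_nonneg zero_le_one, ih, opPow_one hR, pow_succ]

theorem opPow_inner (a : ℝ) (x y : H) : inner ℂ (opPow R a x) y = inner ℂ x (opPow R a y) := by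
  have h : IsSelfAdjoint (opPow R a) := cfc_predicate _ _
  have h2 := ContinuousLinearMap.adjoint_inner_right (opPow R a) x y
  rw [← ContinuousLinearMap.star_eq_adjoint, h.star_eq] at h2
  exact h2.symm

theorem opPow_injective (hR : R.IsPositive) (hinj : ∀ x, R x = 0 → x = 0) {a : ℝ} (ha : 0 ≤ a)
    (x : H) (hx : opPow R a x = 0) : x = 0 := by
  have h := opPow_opPow_apply hR (sub_nonneg.2 (Nat.le_ceil a)) ha x
  rw [hx, map_zero, sub_add_cancel, opPow_natCast hR] at h
  exact injective_pow hinj _ x h.symm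

/-- The bounded operator `(R + ε)⁻¹`. -/
def shiftInv (R : H →L[ℂ] H) (ε : ℝ) : H →L[ℂ] H := cfc (fun r : ℝ => (r + ε)⁻¹) R

theorem continuousOn_shiftInv (hR : R.IsPositive) {ε : ℝ} (hε : 0 < ε) :
    ContinuousOn (fun r : ℝ => (r + ε)⁻¹) (spectrum ℝ R) :=
  ContinuousOn.inv₀ (by fun_prop) fun r hr =>
    (add_pos_of_nonneg_of_pos (spectrum_nonneg_of_isPositive hR hr) hε).ne'

theorem shiftInv_commute (ε a : ℝ) : Commute (shiftInv R ε) (opPow R a) :=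
  cfc_commute_cfc _ _ _

theorem shiftInv_commute_self (hR : R.IsPositive) (ε : ℝ) : Commute (shiftInv R ε) R := by
  have := shiftInv_commute (R := R) ε 1
  rwa [opPow_one hR] at this

theorem shiftInv_mul (hR : R.IsPositive) {ε : ℝ} (hε : 0 < ε) :
    shiftInv R ε * R = cfc (fun r : ℝ => (r + ε)⁻¹ * r) R := by
  have := hR.isSelfAdjoint
  rw [cfc_mul _ _ R (continuousOn_shiftInv hR hε) (continuousOn_id' _), cfc_id' ℝ R, shiftInv]

theorem norm_shiftInv_mul_le (hR : R.IsPositive) {ε : ℝ} (hε : 0 < ε) :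
    ‖shiftInv R ε * R‖ ≤ 1 := by
  rw [shiftInv_mul hR hε]
  refine norm_cfc_le zero_le_one fun r hr => ?_
  have h := spectrum_nonneg_of_isPositive hR hr
  rw [Real.norm_of_nonneg (by positivity), inv_mul_le_one₀ (by positivity)]
  linarith

theorem shiftInv_mul_mul (hR : R.IsPositive) {ε : ℝ} (hε : 0 < ε) :
    shiftInv R ε * R * R = R - ε • (shiftInv R ε * R) := by
  have := hR.isSelfAdjoint
  have hc : ContinuousOn (fun r : ℝ => (r + ε)⁻¹ * r) (spectrum ℝ R) :=
    (continuousOn_shiftInv hR hε).mul continuousOn_id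
  have h1 : shiftInv R ε * R * R = cfc (fun r : ℝ => (r + ε)⁻¹ * r * r) R := by
    rw [shiftInv_mul hR hε, cfc_mul _ _ R hc (continuousOn_id' _), cfc_id' ℝ R]
  have h2 : R - ε • (shiftInv R ε * R) = cfc (fun r : ℝ => r - ε • ((r + ε)⁻¹ * r)) R := by
    have hc' : ContinuousOn (fun r : ℝ => ε • ((r + ε)⁻¹ * r)) (spectrum ℝ R) := hc.const_smul ε
    rw [shiftInv_mul hR hε, cfc_sub _ _ R (continuousOn_id' _) hc',
      cfc_smul ε _ R hc, cfc_id' ℝ R]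
  rw [h1, h2]
  refine cfc_congr fun r hr => ?_
  have h := spectrum_nonneg_of_isPositive hR hr
  have : r + ε ≠ 0 := by positivity
  simp only [smul_eq_mul]
  field_simp
  ring

theorem dense_range_of_injective (hR : R.IsPositive) (hinj : ∀ x, R x = 0 → x = 0) :
    DenseRange R := by
  have h : (LinearMap.range (R : H →ₗ[ℂ] H)).topologicalClosure = ⊤ := by
    rw [Submodule.topologicalClosure_eq_top_iff, Submodule.eq_bot_iff]
    intro x hx
    refine hinj x ?_
    have h1 := (Submodule.mem_orthogonal _ _).1 hx (R (R x)) ⟨R x, rfl⟩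
    have h2 := hR.isSymmetric (R x) x
    simp only [ContinuousLinearMap.coe_coe] at h2
    rw [h2] at h1
    exact inner_self_eq_zero.1 h1
  have h2 := (Submodule.dense_iff_topologicalClosure_eq_top).2 h
  exact h2

/-- The contractions `(R + ε)⁻¹ R` converge strongly to the identity. -/
theorem tendsto_shiftInv_mul (hR : R.IsPositive) (hinj : ∀ x, R x = 0 → x = 0) (x : H) :
    Tendsto (fun ε => (shiftInv R ε * R) x) (𝓝[>] 0) (𝓝 x) := by
  rw [Metric.tendsto_nhds]
  intro δ hδ
  obtain ⟨y, hy⟩ := (dense_range_of_injective hR hinj).exists_dist_lt x (ε := δ / 3) (by positivity)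
  have hsmall : ∀ᶠ ε in 𝓝[>] (0 : ℝ), ε * ‖y‖ < δ / 3 := by
    have h1 : Tendsto (fun ε : ℝ => ε * ‖y‖) (𝓝 0) (𝓝 (0 * ‖y‖)) :=
      (continuous_id.mul continuous_const).tendsto 0
    rw [zero_mul] at h1
    exact (h1.mono_left nhdsWithin_le_nhds).eventually_lt_const (by positivity)
  filter_upwards [hsmall, eventually_mem_nhdsWithin] with ε h1 hε
  have hε : 0 < ε := hε
  have hT : ∀ z, ‖(shiftInv R ε * R) z‖ ≤ ‖z‖ := fun z =>
    ((shiftInv R ε * R).le_opNorm z).trans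
      (mul_le_of_le_one_left (norm_nonneg _) (norm_shiftInv_mul_le hR hε))
  have h2 : (shiftInv R ε * R) (R y) = R y - ε • (shiftInv R ε * R) y := by
    have := congrArg (fun T : H →L[ℂ] H => T y) (shiftInv_mul_mul hR hε)
    exact this
  have h3 : (shiftInv R ε * R) x - x
      = (shiftInv R ε * R) (x - R y) - (x - R y) - ε • (shiftInv R ε * R) y := by
    rw [map_sub, h2]; abel
  rw [dist_eq_norm] at hy
  rw [dist_eq_norm, h3]
  calc _ ≤ ‖x - R y‖ + ‖x - R y‖ + ε * ‖y‖ := by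
        refine (norm_sub_le _ _).trans (add_le_add ((norm_sub_le _ _).trans
          (add_le_add (hT _) le_rfl)) ?_)
        rw [norm_smul, Real.norm_of_nonneg hε.le]
        exact mul_le_mul_of_nonneg_left (hT y) hε.le
    _ < δ := by linarith

theorem tendsto_shiftInv_mul_pow (hR : R.IsPositive) (hinj : ∀ x, R x = 0 → x = 0) (N : ℕ) (x : H) :
    Tendsto (fun ε => ((shiftInv R ε * R) ^ N) x) (𝓝[>] 0) (𝓝 x) := by
  induction N with
  | zero => simp
  | succ N ih =>
    have h1 : Tendsto (fun ε => ((shiftInv R ε * R) ^ N) ((shiftInv R ε * R) x - x))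
        (𝓝[>] 0) (𝓝 0) := by
      have h2 : Tendsto (fun ε => ‖(shiftInv R ε * R) x - x‖) (𝓝[>] 0) (𝓝 0) := by
        rw [← tendsto_iff_norm_sub_tendsto_zero]
        exact tendsto_shiftInv_mul hR hinj x
      refine squeeze_zero_norm' ?_ h2
      filter_upwards [eventually_mem_nhdsWithin] with ε hε
      have h3 : ‖(shiftInv R ε * R) ^ N‖ ≤ 1 := by
        induction N with
        | zero => rw [pow_zero]; exact ContinuousLinearMap.norm_id_le
        | succ N ih' =>
          exact (norm_pow_le' _ N.succ_pos).trans
            (pow_le_one₀ (norm_nonneg _) (norm_shiftInv_mul_le hR hε))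
      exact (((shiftInv R ε * R) ^ N).le_opNorm _).trans (mul_le_of_le_one_left (norm_nonneg _) h3)
    have h4 := h1.add ih
    rw [zero_add] at h4
    refine h4.congr fun ε => ?_
    rw [← map_add, sub_add_cancel, pow_succ]
    rfl

end Powers

/-! ### The energy estimate -/

/-- A bound for the energy in terms of its dissipation. -/
def energyBound (b m : ℝ) : ℝ := 3 / 2 + b ^ 2 / min 1 m

/-- The rate of exponential decay. -/
def decayRate (b m : ℝ) : ℝ := b / (2 * energyBound b m)

/-- The constant in the decay estimate. -/
def decayConst (b m : ℝ) : ℝ := energyBound b m * (2 + |m - 1|) / min (1 / 2) m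

theorem energyBound_pos {b m : ℝ} (hm : 0 < m) : 0 < energyBound b m := by
  unfold energyBound
  have : 0 < min 1 m := lt_min one_pos hm
  positivity

theorem decayRate_pos {b m : ℝ} (hb : 0 < b) (hm : 0 < m) : 0 < decayRate b m :=
  div_pos hb (mul_pos two_pos (energyBound_pos hm))

theorem decayConst_pos {b m : ℝ} (hm : 0 < m) : 0 < decayConst b m :=
  div_pos (mul_pos (energyBound_pos hm) (by positivity)) (lt_min (by norm_num) hm)

/-- Exponential decay for the damped equation `w'' + b w' + (m - 1) w + g = 0`, where `g` stands for
the image of `w` under a self-adjoint operator bounded below by `1`, and `y` for the image of `w`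
under its square root, with derivative `k`; `p` is `w'`. -/
theorem energy_decay {F : Type*} [NormedAddCommGroup F] [InnerProductSpace ℝ F] {b m : ℝ}
    (hb : 0 < b) (hm : 0 < m) {w y p g k : ℝ → F}
    (hw : ∀ t, 0 < t → HasDerivAt w (p t) t) (hy : ∀ t, 0 < t → HasDerivAt y (k t) t)
    (hp : ∀ t, 0 < t → HasDerivAt p (-g t + (1 - m) • w t - b • p t) t)
    (hgp : ∀ t, inner ℝ (y t) (k t) = inner ℝ (g t) (p t))
    (hgw : ∀ t, inner ℝ (g t) (w t) = ‖y t‖ ^ 2) (hwy : ∀ t, ‖w t‖ ≤ ‖y t‖)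
    (hwc : ContinuousOn w (Ici 0)) (hyc : ContinuousOn y (Ici 0)) (hpc : ContinuousOn p (Ici 0))
    {t : ℝ} (ht : 0 ≤ t) :
    ‖y t‖ ^ 2 + ‖p t‖ ^ 2
      ≤ decayConst b m * Real.exp (-2 * decayRate b m * t) * (‖y 0‖ ^ 2 + ‖p 0‖ ^ 2) := by
  set K := energyBound b m with hK
  have hK0 : 0 < K := energyBound_pos hm
  set c := min 1 m with hc
  have hc0 : 0 < c := lt_min one_pos hm
  have hc1 : c ≤ 1 := min_le_left _ _
  have hcm : c ≤ m := min_le_right _ _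
  set E : ℝ → ℝ := fun t => ‖p t‖ ^ 2 + ‖y t‖ ^ 2 + (m - 1) * ‖w t‖ ^ 2 + b * inner ℝ (w t) (p t)
    + b ^ 2 / 2 * ‖w t‖ ^ 2 with hE
  have hwy2 : ∀ t, ‖w t‖ ^ 2 ≤ ‖y t‖ ^ 2 := fun t => by gcongr; exact hwy t
  have hcs : ∀ t, |b * inner ℝ (w t) (p t)| ≤ ‖p t‖ ^ 2 / 2 + b ^ 2 / 2 * ‖w t‖ ^ 2 := fun t => by
    rw [abs_mul, abs_of_pos hb]
    have := abs_real_inner_le_norm (w t) (p t)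
    nlinarith [sq_nonneg (b * ‖w t‖ - ‖p t‖)]
  have ha : ∀ t, c * ‖y t‖ ^ 2 ≤ ‖y t‖ ^ 2 + (m - 1) * ‖w t‖ ^ 2 := fun t => by
    nlinarith [hwy2 t, sq_nonneg ‖w t‖,
      mul_nonneg (sub_nonneg.2 hc1) (sub_nonneg.2 (hwy2 t)),
      mul_nonneg (sub_nonneg.2 hcm) (sq_nonneg ‖w t‖)]
  -- the dissipation controls the energy
  have hEK : ∀ t, E t ≤ K * (‖p t‖ ^ 2 + (‖y t‖ ^ 2 + (m - 1) * ‖w t‖ ^ 2)) := fun t => by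
    have h1 := (abs_le.1 (hcs t)).2
    have h3 : b ^ 2 * ‖w t‖ ^ 2 ≤ b ^ 2 / c * (‖y t‖ ^ 2 + (m - 1) * ‖w t‖ ^ 2) := by
      calc b ^ 2 * ‖w t‖ ^ 2 ≤ b ^ 2 * ‖y t‖ ^ 2 := by gcongr; exact hwy t
        _ = b ^ 2 / c * (c * ‖y t‖ ^ 2) := by field_simp
        _ ≤ _ := by gcongr; exact ha t
    have h4 : 0 ≤ ‖y t‖ ^ 2 + (m - 1) * ‖w t‖ ^ 2 := le_trans (by positivity) (ha t)
    have h5 : 0 ≤ b ^ 2 / c * ‖p t‖ ^ 2 := by positivity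
    simp only [hE, hK, energyBound, ← hc]
    nlinarith
  have hElow : ∀ t, min (1 / 2) m * (‖y t‖ ^ 2 + ‖p t‖ ^ 2) ≤ E t := fun t => by
    have h1 := (abs_le.1 (hcs t)).1
    have h2 : min (1 / 2) m * ‖p t‖ ^ 2 ≤ 1 / 2 * ‖p t‖ ^ 2 := by gcongr; exact min_le_left _ _
    have h3 : min (1 / 2) m * ‖y t‖ ^ 2 ≤ c * ‖y t‖ ^ 2 := by
      gcongr
      exact min_le_min_right _ (by norm_num)
    simp only [hE]
    linarith [ha t]
  have hEup : ∀ t, E t ≤ K * (2 + |m - 1|) * (‖y t‖ ^ 2 + ‖p t‖ ^ 2) := fun t => by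
    have h1 : (m - 1) * ‖w t‖ ^ 2 ≤ |m - 1| * ‖y t‖ ^ 2 :=
      (mul_le_mul_of_nonneg_right (le_abs_self _) (sq_nonneg _)).trans
        (mul_le_mul_of_nonneg_left (hwy2 t) (abs_nonneg _))
    refine (hEK t).trans ?_
    rw [mul_assoc]
    refine mul_le_mul_of_nonneg_left ?_ hK0.le
    nlinarith [mul_nonneg (abs_nonneg (m - 1)) (sq_nonneg ‖p t‖), sq_nonneg ‖p t‖,
      sq_nonneg ‖y t‖]
  have hEderiv : ∀ t, 0 < t →
      HasDerivAt E (-b * (‖p t‖ ^ 2 + (‖y t‖ ^ 2 + (m - 1) * ‖w t‖ ^ 2))) t := fun t ht => by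
    have h1 := (((((hp t ht).norm_sq).add (hy t ht).norm_sq).add
      (((hw t ht).norm_sq).const_mul (m - 1))).add
      (((hw t ht).inner ℝ (hp t ht)).const_mul b)).add (((hw t ht).norm_sq).const_mul (b ^ 2 / 2))
    refine h1.congr_deriv ?_
    simp only [inner_add_right, inner_sub_right, inner_neg_right, inner_smul_right,
      real_inner_self_eq_norm_sq, hgp t]
    rw [real_inner_comm (g t) (w t), hgw t, real_inner_comm (g t) (p t),
      real_inner_comm (w t) (p t)]
    ring
  -- hence the energy, multiplied by the exponential weight, does not increase
  have hanti : AntitoneOn (fun t => Real.exp (2 * decayRate b m * t) * E t) (Ici 0) := by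
    have hEc : ContinuousOn E (Ici 0) :=
      ((((hpc.norm.pow 2).add (hyc.norm.pow 2)).add (continuousOn_const.mul (hwc.norm.pow 2))).add
        (continuousOn_const.mul (hwc.inner hpc))).add (continuousOn_const.mul (hwc.norm.pow 2))
    have hexp : ∀ t : ℝ, HasDerivAt (fun t => Real.exp (2 * decayRate b m * t))
        (Real.exp (2 * decayRate b m * t) * (2 * decayRate b m)) t := fun t => by
      simpa using ((hasDerivAt_id t).const_mul (2 * decayRate b m)).exp
    refine antitoneOn_of_deriv_nonpos (convex_Ici 0) ?_ ?_ ?_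
    · exact ContinuousOn.mul (by fun_prop) hEc
    · rw [interior_Ici]
      exact fun s hs => ((hexp s).mul (hEderiv s hs)).differentiableAt.differentiableWithinAt
    · rw [interior_Ici]
      intro s hs
      have h1 := ((hexp s).mul (hEderiv s hs)).deriv
      change deriv ((fun t => Real.exp (2 * decayRate b m * t)) * E) s ≤ 0
      rw [h1]
      have h2 : 2 * decayRate b m * E s ≤ b * (‖p s‖ ^ 2 + (‖y s‖ ^ 2 + (m - 1) * ‖w s‖ ^ 2)) := by
        have h3 : 2 * decayRate b m * K = b := by
          simp only [decayRate, ← hK]; field_simp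
        calc 2 * decayRate b m * E s ≤ 2 * decayRate b m * (K * _) :=
              mul_le_mul_of_nonneg_left (hEK s) (by linarith [decayRate_pos hb hm])
          _ = _ := by rw [← mul_assoc, h3]
      nlinarith [Real.exp_pos (2 * decayRate b m * s)]
  have h1 := hanti (mem_Ici.2 le_rfl) (mem_Ici.2 ht) ht
  simp only [mul_zero, Real.exp_zero, one_mul] at h1
  have h2 : E t ≤ Real.exp (-2 * decayRate b m * t) * E 0 := by
    calc E t = Real.exp (-2 * decayRate b m * t) * (Real.exp (2 * decayRate b m * t) * E t) := by
          rw [← mul_assoc, ← Real.exp_add]; ring_nf; simp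
      _ ≤ _ := mul_le_mul_of_nonneg_left h1 (Real.exp_pos _).le
  have hmin : 0 < min (1 / 2) m := lt_min (by norm_num) hm
  have h3 : min (1 / 2) m * (‖y t‖ ^ 2 + ‖p t‖ ^ 2)
      ≤ Real.exp (-2 * decayRate b m * t) * (K * (2 + |m - 1|) * (‖y 0‖ ^ 2 + ‖p 0‖ ^ 2)) :=
    (hElow t).trans (h2.trans (mul_le_mul_of_nonneg_left (hEup 0) (Real.exp_pos _).le))
  rw [decayConst, ← hK, mul_comm (K * (2 + |m - 1|) / _), mul_assoc, div_mul_eq_mul_div,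
    ← mul_div_assoc, le_div_iff₀ hmin]
  linarith

/-! ### The damped wave equation in a Hilbert space -/

section Evolution

variable {H : Type*} [NormedAddCommGroup H] [InnerProductSpace ℂ H] [CompleteSpace H]
  {R : H →L[ℂ] H} {b m : ℝ}

/-- A bounded operator acting on both components. -/
def diag (T : H →L[ℂ] H) : H × H →L[ℂ] H × H := T.prodMap T

/-- The generator of the first-order system: if `R = (I - 𝓛)⁻¹` and `(G, K)` represents
`(u, ∂ₜ u)` in `H^s × H^(s-1)`, then its image represents the time derivative in
`H^(s-1) × H^(s-2)`. -/
def waveGen (R : H →L[ℂ] H) (b m : ℝ) : H × H →L[ℂ] H × H :=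
  (ContinuousLinearMap.snd ℂ H H).prod
    (-ContinuousLinearMap.fst ℂ H H + ((1 - m : ℝ) : ℂ) • R ∘L ContinuousLinearMap.fst ℂ H H
      - (b : ℂ) • opPow R (1 / 2) ∘L ContinuousLinearMap.snd ℂ H H)

/-- Solutions of the damped wave equation in terms of representatives in a Hilbert space. The
derivative exists after a loss of one order of regularity, whence the factor `R ^ (1 / 2)`. -/
structure IsEvolution (R : H →L[ℂ] H) (b m : ℝ) (V : ℝ → H × H) : Prop where
  continuousOn : ContinuousOn V (Ici 0)
  hasDerivAt : ∀ t, 0 < t →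
    HasDerivAt (fun t => diag (opPow R (1 / 2)) (V t)) (waveGen R b m (V t)) t

theorem waveGen_diag {T : H →L[ℂ] H} (h1 : Commute T R) (h2 : Commute T (opPow R (1 / 2)))
    (V : H × H) : waveGen R b m (diag T V) = diag T (waveGen R b m V) := by
  have e1 : ∀ x, T (R x) = R (T x) := fun x => congrArg (fun A : H →L[ℂ] H => A x) h1
  have e2 : ∀ x, T (opPow R (1 / 2) x) = opPow R (1 / 2) (T x) :=
    fun x => congrArg (fun A : H →L[ℂ] H => A x) h2
  refine Prod.ext rfl ?_
  change -T V.1 + (((1 - m : ℝ) : ℂ)) • R (T V.1) - (b : ℂ) • opPow R (1 / 2) (T V.2)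
    = T (-V.1 + (((1 - m : ℝ) : ℂ)) • R V.1 - (b : ℂ) • opPow R (1 / 2) V.2)
  rw [map_sub, map_add, map_neg, map_smul, map_smul, e1, e2]

theorem diag_diag_comm {H : Type*} [NormedAddCommGroup H] [InnerProductSpace ℂ H]
    {T T' : H →L[ℂ] H} (h : Commute T T') (V : H × H) :
    diag T (diag T' V) = diag T' (diag T V) :=
  Prod.ext (congrArg (fun A : H →L[ℂ] H => A V.1) h) (congrArg (fun A : H →L[ℂ] H => A V.2) h)

theorem _root_.ContinuousLinearMap.hasDerivAt_comp_real {E F : Type*} [NormedAddCommGroup E]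
    [NormedSpace ℂ E] [NormedAddCommGroup F] [NormedSpace ℂ F] (T : E →L[ℂ] F) {f : ℝ → E} {f' : E}
    {t : ℝ} (h : HasDerivAt f f' t) : HasDerivAt (fun t => T (f t)) (T f') t :=
  (T.restrictScalars ℝ).hasFDerivAt.comp_hasDerivAt t h

theorem IsEvolution.diag {V : ℝ → H × H} (hV : IsEvolution R b m V) {T : H →L[ℂ] H}
    (h1 : Commute T R) (h2 : Commute T (opPow R (1 / 2))) :
    IsEvolution R b m fun t => diag T (V t) where
  continuousOn := (Heisenberg.diag T).continuous.comp_continuousOn hV.continuousOn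
  hasDerivAt t ht := by
    have := (Heisenberg.diag T).hasDerivAt_comp_real (hV.hasDerivAt t ht)
    rw [← waveGen_diag h1 h2] at this
    simpa only [diag_diag_comm h2] using this

theorem IsEvolution.decay (hR : R.IsPositive) (hR1 : ‖R‖ ≤ 1) (hb : 0 < b) (hm : 0 < m)
    {V : ℝ → H × H} (hV : IsEvolution R b m V) {t : ℝ} (ht : 0 ≤ t) :
    ‖opPow R (1 / 2) (V t).1‖ ^ 2 + ‖opPow R (1 / 2) (V t).2‖ ^ 2
      ≤ decayConst b m * Real.exp (-2 * decayRate b m * t) *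
        (‖opPow R (1 / 2) (V 0).1‖ ^ 2 + ‖opPow R (1 / 2) (V 0).2‖ ^ 2) := by
  let _ : InnerProductSpace ℝ H := InnerProductSpace.rclikeToReal ℂ H
  set S := opPow R (1 / 2) with hS
  have hSS : ∀ x, S (S x) = R x := fun x => by
    rw [hS, opPow_opPow_apply hR (by norm_num) (by norm_num)]
    norm_num [opPow_one hR]
  have hsym : ∀ x y, inner ℝ (S x) y = inner ℝ x (S y) := fun x y => by
    rw [real_inner_eq_re_inner ℂ, real_inner_eq_re_inner ℂ, opPow_inner]
  have hS1 : ∀ x, ‖S x‖ ≤ ‖x‖ := fun x => by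
    have h1 : ‖S x‖ ^ 2 = inner ℝ x (R x) := by
      rw [← real_inner_self_eq_norm_sq, hsym, hSS]
    have h2 : inner ℝ x (R x) ≤ ‖x‖ * ‖x‖ := (real_inner_le_norm _ _).trans
      (mul_le_mul_of_nonneg_left ((R.le_opNorm x).trans
        (mul_le_of_le_one_left (norm_nonneg _) hR1)) (norm_nonneg _))
    nlinarith [norm_nonneg x, norm_nonneg (S x)]
  have hy : ∀ t, 0 < t → HasDerivAt (fun t => S (V t).1) (V t).2 t := fun t ht =>
    (ContinuousLinearMap.fst ℂ H H).hasDerivAt_comp_real (hV.hasDerivAt t ht)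
  have hp : ∀ t, 0 < t → HasDerivAt (fun t => S (V t).2)
      (-(V t).1 + (1 - m) • R (V t).1 - b • S (V t).2) t := fun t ht =>
    (ContinuousLinearMap.snd ℂ H H).hasDerivAt_comp_real (hV.hasDerivAt t ht)
  have hw : ∀ t, 0 < t → HasDerivAt (fun t => R (V t).1) (S (V t).2) t := fun t ht => by
    simpa only [hSS] using S.hasDerivAt_comp_real (hy t ht)
  exact energy_decay hb hm (w := fun t => R (V t).1) (y := fun t => S (V t).1)
    (p := fun t => S (V t).2) (g := fun t => (V t).1) (k := fun t => (V t).2) hw hy hp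
    (fun t => hsym _ _) (fun t => by rw [← real_inner_self_eq_norm_sq, hsym, hSS])
    (fun t => by rw [← hSS]; exact hS1 _)
    (R.continuous.comp_continuousOn (continuous_fst.comp_continuousOn hV.continuousOn))
    (S.continuous.comp_continuousOn (continuous_fst.comp_continuousOn hV.continuousOn))
    (S.continuous.comp_continuousOn (continuous_snd.comp_continuousOn hV.continuousOn)) ht

/-- Propagation of regularity: if the initial value lies in the range of a power of `R`, so does the
solution, with exponential decay of the preimage. The preimage is the limit of the evolutions
`(R + ε)^(-N) V`, which form a Cauchy family by the energy estimate for their differences. -/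
theorem IsEvolution.exists_preimage (hR : R.IsPositive) (hR1 : ‖R‖ ≤ 1)
    (hinj : ∀ x, R x = 0 → x = 0) (hb : 0 < b) (hm : 0 < m)
    {V : ℝ → H × H} (hV : IsEvolution R b m V) (N : ℕ) {W₀ : H × H}
    (h0 : Heisenberg.diag (opPow R (1 / 2)) (V 0) = Heisenberg.diag (R ^ N) W₀)
    {t : ℝ} (ht : 0 ≤ t) :
    ∃ W : H × H, Heisenberg.diag (opPow R (1 / 2)) (V t) = Heisenberg.diag (R ^ N) W ∧
      ‖W.1‖ ^ 2 + ‖W.2‖ ^ 2 ≤ decayConst b m * Real.exp (-2 * decayRate b m * t) *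
        (‖W₀.1‖ ^ 2 + ‖W₀.2‖ ^ 2) := by
  set S := opPow R (1 / 2) with hS
  set c := decayConst b m * Real.exp (-2 * decayRate b m * t) with hc
  have hc0 : 0 < c := mul_pos (decayConst_pos hm) (Real.exp_pos _)
  set B : ℝ → H →L[ℂ] H := fun ε => shiftInv R ε ^ N with hB
  have hBR : ∀ ε, Commute (B ε) R := fun ε => (shiftInv_commute_self hR ε).pow_left N
  have hBS : ∀ ε, Commute (B ε) S := fun ε => (shiftInv_commute ε _).pow_left N
  have hBT : ∀ ε x, B ε ((R ^ N) x) = ((shiftInv R ε * R) ^ N) x := fun ε x => by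
    rw [(shiftInv_commute_self hR ε).mul_pow]; rfl
  -- the energy estimate for an operator `T` commuting with the equation
  have hest : ∀ T : H →L[ℂ] H, Commute T R → Commute T S →
      ‖T (S (V t).1)‖ ^ 2 + ‖T (S (V t).2)‖ ^ 2
        ≤ c * (‖T ((R ^ N) W₀.1)‖ ^ 2 + ‖T ((R ^ N) W₀.2)‖ ^ 2) := by
    intro T h1 h2
    have e2 : ∀ x, T (S x) = S (T x) := fun x => congrArg (fun A : H →L[ℂ] H => A x) h2
    have h3 := (hV.diag h1 h2).decay hR hR1 hb hm ht
    have h4 : S (V 0).1 = (R ^ N) W₀.1 := congrArg Prod.fst h0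
    have h5 : S (V 0).2 = (R ^ N) W₀.2 := congrArg Prod.snd h0
    rw [← h4, ← h5]
    simp only [e2]
    exact h3
  set Z : ℝ → H × H := fun ε => Heisenberg.diag (B ε) (Heisenberg.diag S (V t)) with hZ
  set A : ℝ → H × H := fun ε => Heisenberg.diag ((shiftInv R ε * R) ^ N) W₀ with hA
  have hAlim : Tendsto A (𝓝[>] 0) (𝓝 W₀) :=
    (tendsto_shiftInv_mul_pow hR hinj N W₀.1).prodMk_nhds (tendsto_shiftInv_mul_pow hR hinj N W₀.2)
  have hdist : ∀ ε ε', dist (Z ε) (Z ε') ≤ √(2 * c) * dist (A ε) (A ε') := by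
    intro ε ε'
    have h1 := hest (B ε - B ε') ((hBR ε).sub_left (hBR ε')) ((hBS ε).sub_left (hBS ε'))
    simp only [sub_apply, hBT] at h1
    set d := dist (A ε) (A ε') with hd
    have hd1 : ‖((shiftInv R ε * R) ^ N) W₀.1 - ((shiftInv R ε' * R) ^ N) W₀.1‖ ≤ d := by
      rw [hd, dist_eq_norm]; exact norm_fst_le (A ε - A ε')
    have hd2 : ‖((shiftInv R ε * R) ^ N) W₀.2 - ((shiftInv R ε' * R) ^ N) W₀.2‖ ≤ d := by
      rw [hd, dist_eq_norm]; exact norm_snd_le (A ε - A ε')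
    have hle : ‖B ε (S (V t).1) - B ε' (S (V t).1)‖ ^ 2
        + ‖B ε (S (V t).2) - B ε' (S (V t).2)‖ ^ 2 ≤ 2 * c * d ^ 2 := by
      refine h1.trans ?_
      have := pow_le_pow_left₀ (norm_nonneg _) hd1 2
      have := pow_le_pow_left₀ (norm_nonneg _) hd2 2
      nlinarith
    have hsq : √(2 * c) * d = √(2 * c * d ^ 2) := by
      rw [Real.sqrt_mul (mul_nonneg zero_le_two hc0.le) (d ^ 2), Real.sqrt_sq dist_nonneg]
    rw [hsq, dist_eq_norm]
    refine max_le ?_ ?_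
    · exact Real.le_sqrt_of_sq_le ((le_add_of_nonneg_right (sq_nonneg _)).trans hle)
    · exact Real.le_sqrt_of_sq_le ((le_add_of_nonneg_left (sq_nonneg _)).trans hle)
  obtain ⟨W, hW⟩ : ∃ W, Tendsto Z (𝓝[>] 0) (𝓝 W) := by
    refine cauchy_map_iff_exists_tendsto.1 (Metric.cauchy_iff.2 ⟨inferInstance, fun δ hδ => ?_⟩)
    have hs0 : 0 ≤ √(2 * c) := Real.sqrt_nonneg _
    obtain ⟨s, hs, hsd⟩ := (Metric.cauchy_iff.1 hAlim.cauchy_map).2 (δ / (√(2 * c) + 1))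
      (by positivity)
    refine ⟨Z '' (A ⁻¹' s), image_mem_map hs, ?_⟩
    rintro _ ⟨ε, hε, rfl⟩ _ ⟨ε', hε', rfl⟩
    have h1 := hsd _ hε _ hε'
    rw [lt_div_iff₀ (by positivity)] at h1
    nlinarith [hdist ε ε', dist_nonneg (x := A ε) (y := A ε')]
  refine ⟨W, ?_, ?_⟩
  · have h1 : Tendsto (fun ε => Heisenberg.diag (R ^ N) (Z ε)) (𝓝[>] 0)
        (𝓝 (Heisenberg.diag (R ^ N) W)) := ((Heisenberg.diag (R ^ N)).continuous.tendsto W).comp hW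
    have h2 : ∀ ε, Heisenberg.diag (R ^ N) (Z ε)
        = Heisenberg.diag ((shiftInv R ε * R) ^ N) (Heisenberg.diag S (V t)) := fun ε => by
      rw [hZ, diag_diag_comm ((hBR ε).pow_right N).symm]
      exact Prod.ext (hBT ε _) (hBT ε _)
    simp only [h2] at h1
    have h3 : Tendsto (fun ε => Heisenberg.diag ((shiftInv R ε * R) ^ N) (Heisenberg.diag S (V t)))
        (𝓝[>] 0) (𝓝 (Heisenberg.diag S (V t))) :=
      (tendsto_shiftInv_mul_pow hR hinj N _).prodMk_nhds (tendsto_shiftInv_mul_pow hR hinj N _)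
    exact tendsto_nhds_unique h3 h1
  · have h1 : ∀ ε, ‖(Z ε).1‖ ^ 2 + ‖(Z ε).2‖ ^ 2 ≤ c * (‖(A ε).1‖ ^ 2 + ‖(A ε).2‖ ^ 2) :=
      fun ε => by
      have := hest (B ε) (hBR ε) (hBS ε)
      simp only [hBT] at this
      exact this
    have hn : Continuous fun V : H × H => ‖V.1‖ ^ 2 + ‖V.2‖ ^ 2 := by fun_prop
    exact le_of_tendsto_of_tendsto' ((hn.tendsto W).comp hW)
      (((hn.tendsto W₀).comp hAlim).const_mul c) h1

theorem waveGen_pow_diag {T : H →L[ℂ] H} (h1 : Commute T R) (h2 : Commute T (opPow R (1 / 2)))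
    (i : ℕ) (V : H × H) :
    (waveGen R b m ^ i) (Heisenberg.diag T V) = Heisenberg.diag T ((waveGen R b m ^ i) V) := by
  induction i with
  | zero => rfl
  | succ i ih =>
    rw [pow_succ']
    change waveGen R b m ((waveGen R b m ^ i) _) = _
    rw [ih, waveGen_diag h1 h2]
    rfl

/-- Applying the generator is differentiation in time, up to the loss of one order. -/
theorem IsEvolution.hasDerivAt_waveGen_pow (hR : R.IsPositive) {V : ℝ → H × H}
    (hV : IsEvolution R b m V) (i : ℕ) {t : ℝ} (ht : 0 < t) :
    HasDerivAt (fun t => Heisenberg.diag (opPow R (1 / 2)) ((waveGen R b m ^ i) (V t)))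
      ((waveGen R b m ^ (i + 1)) (V t)) t := by
  have hSR : Commute (opPow R (1 / 2)) R := by
    have : Commute (opPow R (1 / 2)) (opPow R 1) := cfc_commute_cfc _ _ _
    rwa [opPow_one hR] at this
  have h1 := (waveGen R b m ^ i).hasDerivAt_comp_real (hV.hasDerivAt t ht)
  simp only [waveGen_pow_diag hSR (Commute.refl _)] at h1
  rw [pow_succ]
  exact h1

end Evolution

section

variable {n : ℕ}

/-! ### Bessel potentials of test functions and Sobolev spaces -/

theorem resolvent_pow_oneSubLap_iterate (j : ℕ) (φ : Test n) :
    (subLaplacianResolvent n ^ j) (toL2 ((oneSubLap n)^[j] φ)) = toL2 φ := by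
  induction j generalizing φ with
  | zero => rfl
  | succ j ih =>
    rw [pow_succ', Function.iterate_succ_apply]
    change subLaplacianResolvent n ((subLaplacianResolvent n ^ j) _) = _
    rw [ih, resolvent_oneSubLap]

/-- The number `⌈σ⌉₊` in the definition of `besselTest` may be replaced by any larger one. -/
theorem besselTest_eq {σ : ℝ} {k : ℕ} (hk : σ ≤ k) (φ : Test n) :
    besselTest σ φ = opPow (subLaplacianResolvent n) (k - σ) (toL2 ((oneSubLap n)^[k] φ)) := by
  obtain ⟨j, hj⟩ := Nat.exists_eq_add_of_le (Nat.ceil_le.2 hk)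
  have hfun : (fun ψ : Test n => ψ - subLaplacian ψ) = oneSubLap n :=
    funext fun ψ => (oneSubLap_apply ψ).symm
  have h0 : 0 ≤ (⌈σ⌉₊ : ℝ) - σ := sub_nonneg.2 (Nat.le_ceil σ)
  rw [besselTest, hfun]
  have hexp : (k : ℝ) - σ = (⌈σ⌉₊ - σ) + j := by rw [hj]; push_cast; ring
  rw [hexp, ← opPow_opPow_apply resolvent_isPositive h0 j.cast_nonneg,
    opPow_natCast resolvent_isPositive, hj, add_comm ⌈σ⌉₊ j, Function.iterate_add_apply,
    resolvent_pow_oneSubLap_iterate]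

theorem opPow_besselTest {a : ℝ} (ha : 0 ≤ a) (σ : ℝ) (φ : Test n) :
    opPow (subLaplacianResolvent n) a (besselTest σ φ) = besselTest (σ - a) φ := by
  have h0 : 0 ≤ (⌈σ⌉₊ : ℝ) - σ := sub_nonneg.2 (Nat.le_ceil σ)
  rw [besselTest_eq (Nat.le_ceil σ), opPow_opPow_apply resolvent_isPositive ha h0,
    besselTest_eq (k := ⌈σ⌉₊) (by linarith [Nat.le_ceil σ])]
  congr 2
  ring

theorem besselTest_oneSubLap (σ : ℝ) (φ : Test n) :
    besselTest σ (oneSubLap n φ) = besselTest (σ + 1) φ := by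
  have h : σ + 1 ≤ ((⌈σ⌉₊ + 1 : ℕ) : ℝ) := by push_cast; linarith [Nat.le_ceil σ]
  rw [besselTest_eq (Nat.le_ceil σ), besselTest_eq h, Function.iterate_succ_apply]
  congr 2
  push_cast; ring

/-- The elements `(I - 𝓛)^σ φ` are total in `L²`, for every real `σ`. -/
theorem eq_zero_of_inner_besselTest (σ : ℝ) (g : L2 n)
    (h : ∀ φ : Test n, inner ℂ (besselTest σ φ) g = 0) : g = 0 := by
  refine opPow_injective resolvent_isPositive resolvent_injective
    (sub_nonneg.2 (Nat.le_ceil σ)) g ?_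
  refine eq_zero_of_inner_oneSubLap_iterate ⌈σ⌉₊ _ fun φ => ?_
  rw [← opPow_inner, ← besselTest_eq (Nat.le_ceil σ)]
  exact h φ

theorem eq_of_inner_besselTest (σ : ℝ) {g g' : L2 n}
    (h : ∀ φ : Test n, inner ℂ (besselTest σ φ) g = inner ℂ (besselTest σ φ) g') : g = g' := by
  rw [← sub_eq_zero]
  refine eq_zero_of_inner_besselTest σ _ fun φ => ?_
  rw [inner_sub_right, h, sub_self]

theorem IsBesselDeriv.unique {s : ℝ} {f : Distr n} {g g' : L2 n} (h : IsBesselDeriv s f g)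
    (h' : IsBesselDeriv s f g') : g = g' :=
  eq_of_inner_besselTest (-s / 2) fun φ => by rw [← h φ, ← h' φ]

theorem IsBesselDeriv.sobolevNorm_eq {s : ℝ} {f : Distr n} {g : L2 n} (h : IsBesselDeriv s f g) :
    sobolevNorm s f = ‖g‖ₑ :=
  le_antisymm (iInf₂_le g h) (le_iInf₂ fun g' h' => by rw [h.unique h'])

theorem IsBesselDeriv.sub {s : ℝ} {f f' : Distr n} {g g' : L2 n} (h : IsBesselDeriv s f g)
    (h' : IsBesselDeriv s f' g') : IsBesselDeriv s (f - f') (g - g') := fun φ => by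
  rw [inner_sub_right, ← h φ, ← h' φ]; rfl

theorem IsBesselDeriv.smul {s : ℝ} {f : Distr n} {g : L2 n} (h : IsBesselDeriv s f g) (c : ℝ) :
    IsBesselDeriv s (c • f) ((c : ℂ) • g) := fun φ => by
  rw [inner_smul_right, ← h φ]
  exact (Complex.real_smul (x := c) (z := f φ))

/-- Lowering the order of the Sobolev space. -/
theorem IsBesselDeriv.opPow {s a s' : ℝ} (ha : 0 ≤ a) (hs : s' = s - 2 * a) {f : Distr n} {g : L2 n}
    (h : IsBesselDeriv s f g) : IsBesselDeriv s' f (opPow (subLaplacianResolvent n) a g) :=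
  fun φ => by
    rw [← opPow_inner, opPow_besselTest ha, h φ]
    congr 2
    rw [hs]; ring

/-- The distribution `φ ↦ ⟪(I - 𝓛)^σ φ, g⟫`. -/
def besselDistr (σ : ℝ) (g : L2 n) : Distr n where
  toFun φ := pairL2 (opPow (subLaplacianResolvent n) (⌈σ⌉₊ - σ) g) ((oneSubLap n ^ ⌈σ⌉₊) φ)
  map_add' φ ψ := by simp only [map_add]
  map_smul' c φ := by simp only [map_smul, RingHom.id_apply]
  cont := by
    refine (continuous_pairL2 _).comp ?_
    change Continuous ((oneSubLap n ^ ⌈σ⌉₊ : Test n →ₗ[ℝ] Test n) : Test n → Test n)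
    rw [Module.End.coe_pow]
    exact continuous_oneSubLap.iterate _

theorem besselDistr_apply (σ : ℝ) (g : L2 n) (φ : Test n) :
    besselDistr σ g φ = inner ℂ (besselTest σ φ) g := by
  change pairL2 _ _ = _
  rw [pairL2_apply, ← opPow_inner, besselTest_eq (Nat.le_ceil σ), Module.End.pow_apply]

theorem isBesselDeriv_besselDistr (s : ℝ) (g : L2 n) :
    IsBesselDeriv s (besselDistr (-s / 2) g) g := fun _ => besselDistr_apply _ _ _

/-! ### Representatives of solutions -/

/-- A weak derivative, tested against a total family, that is continuous is a strong derivative. -/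
theorem hasDerivAt_of_weak {H : Type*} [NormedAddCommGroup H] [InnerProductSpace ℂ H]
    [CompleteSpace H] {ι : Type*} {a : ι → H} (ha : ∀ x, (∀ i, inner ℂ (a i) x = 0) → x = 0)
    {p q : ℝ → H} (hq : ContinuousOn q (Ici 0))
    (h : ∀ i t, 0 < t → HasDerivAt (fun τ => inner ℂ (a i) (p τ)) (inner ℂ (a i) (q t)) t)
    {t : ℝ} (ht : 0 < t) : HasDerivAt p (q t) t := by
  set q' : ℝ → H := fun t => q (max t 0) with hq'
  have hq'c : Continuous q' := hq.comp_continuous (by fun_prop) fun t =>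
    mem_Ici.2 (le_max_right _ _)
  have hP : ∀ t, HasDerivAt (fun t => ∫ s in (0 : ℝ)..t, q' s) (q' t) t := fun t =>
    intervalIntegral.integral_hasDerivAt_right (hq'c.intervalIntegrable _ _)
      (hq'c.stronglyMeasurableAtFilter _ _) hq'c.continuousAt
  set P : ℝ → H := fun t => ∫ s in (0 : ℝ)..t, q' s with hPdef
  have hder : ∀ i t, 0 < t → HasDerivAt (fun τ => inner ℂ (a i) (p τ - P τ)) 0 t := by
    intro i t ht
    have h1 : HasDerivAt (fun τ => inner ℂ (a i) (P τ)) (inner ℂ (a i) (q' t)) t :=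
      (innerSL ℂ (a i)).hasDerivAt_comp_real (hP t)
    have h2 := (h i t ht).sub h1
    have h3 : q' t = q t := by rw [hq']; simp only [max_eq_left ht.le]
    rw [h3, sub_self] at h2
    refine h2.congr_of_eventuallyEq (Eventually.of_forall fun τ => ?_)
    exact inner_sub_right _ _ _
  have hconst : ∀ τ, 0 < τ → p τ = P τ + (p 1 - P 1) := by
    intro τ hτ
    have h1 : (p τ - P τ) - (p 1 - P 1) = 0 := by
      refine ha _ fun i => ?_
      rw [inner_sub_right, sub_eq_zero]
      exact isOpen_Ioi.is_const_of_deriv_eq_zero isPreconnected_Ioi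
        (fun t ht => (hder i t ht).differentiableAt.differentiableWithinAt)
        (fun t ht => (hder i t ht).deriv) (mem_Ioi.2 hτ) (mem_Ioi.2 one_pos)
    rw [sub_eq_zero] at h1
    rw [← h1]; abel
  have h3 : q' t = q t := by rw [hq']; simp only [max_eq_left ht.le]
  rw [← h3]
  refine ((hP t).add_const (p 1 - P 1)).congr_of_eventuallyEq ?_
  filter_upwards [lt_mem_nhds ht] with τ hτ using hconst τ hτ

/-- The first equation of the system may be given as a convergence of difference quotients, the
second one weakly, as for distributional solutions. -/
theorem IsEvolution.of_weak {H : Type*} [NormedAddCommGroup H] [InnerProductSpace ℂ H]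
    [CompleteSpace H] {R : H →L[ℂ] H} {b m : ℝ} {ι : Type*} {a : ι → H}
    (ha : ∀ x, (∀ i, inner ℂ (a i) x = 0) → x = 0) {g k : ℝ → H}
    (hg : ContinuousOn g (Ici 0)) (hk : ContinuousOn k (Ici 0))
    (h1 : ∀ t, 0 < t → Tendsto (fun τ => ‖(((τ - t)⁻¹ : ℝ) : ℂ) •
      (opPow R (1 / 2) (g τ) - opPow R (1 / 2) (g t)) - k t‖ₑ) (𝓝[≠] t) (𝓝 0))
    (h2 : ∀ i t, 0 < t → HasDerivAt (fun τ => inner ℂ (a i) (opPow R (1 / 2) (k τ)))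
      (inner ℂ (a i)
        (-g t + ((1 - m : ℝ) : ℂ) • R (g t) - (b : ℂ) • opPow R (1 / 2) (k t))) t) :
    IsEvolution R b m fun t => (g t, k t) where
  continuousOn := hg.prodMk hk
  hasDerivAt t ht := by
    refine HasDerivAt.prodMk (f₁ := fun t => opPow R (1 / 2) (g t))
      (f₂ := fun t => opPow R (1 / 2) (k t)) ?_ ?_
    · rw [hasDerivAt_iff_tendsto_slope, tendsto_iff_edist_tendsto_0]
      refine (h1 t ht).congr fun τ => ?_
      rw [edist_eq_enorm_sub, slope_def_module, Complex.coe_smul]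
      rfl
    · have hqc : ContinuousOn (fun t => -g t + ((1 - m : ℝ) : ℂ) • R (g t)
          - (b : ℂ) • opPow R (1 / 2) (k t)) (Ici 0) :=
        (hg.neg.add ((R.continuous.comp_continuousOn hg).const_smul _)).sub
          (((opPow R (1 / 2)).continuous.comp_continuousOn hk).const_smul _)
      exact hasDerivAt_of_weak ha hqc h2 ht

theorem continuousOn_of_continuousInSobolev {r : ℝ} {u : ℝ → Distr n} {g : ℝ → L2 n}
    (hu : ContinuousInSobolev r u) (hg : ∀ t, 0 ≤ t → IsBesselDeriv r (u t) (g t)) :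
    ContinuousOn g (Ici 0) := by
  intro t ht
  have h1 := (hu t ht).2
  rw [ContinuousWithinAt, tendsto_iff_edist_tendsto_0]
  refine h1.congr' ?_
  filter_upwards [self_mem_nhdsWithin] with τ hτ
  rw [((hg τ hτ).sub (hg t ht)).sobolevNorm_eq, edist_eq_enorm_sub]

/-- A solution is represented by an evolution in `L² × L²`. -/
theorem IsSolution.exists_isEvolution {b m : ℝ} {u₀ u₁ : Distr n} {u : ℝ → Distr n}
    (h : IsSolution b m u₀ u₁ u) :
    ∃ (r : ℝ) (V : ℝ → L2 n × L2 n), IsEvolution (subLaplacianResolvent n) b m V ∧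
      (∀ t, 0 ≤ t → IsBesselDeriv r (u t) (V t).1) ∧ IsBesselDeriv r u₀ (V 0).1 ∧
      IsBesselDeriv (r - 1) u₁ (V 0).2 := by
  obtain ⟨r, v, hu, hv, huv, heq, rfl, rfl⟩ := h
  have hg : ∀ t, ∃ g : L2 n, 0 ≤ t → IsBesselDeriv r (u t) g := fun t => by
    by_cases ht : 0 ≤ t
    · obtain ⟨g, hg⟩ := (hu t ht).1; exact ⟨g, fun _ => hg⟩
    · exact ⟨0, fun h => absurd h ht⟩
  have hk : ∀ t, ∃ k : L2 n, 0 ≤ t → IsBesselDeriv (r - 1) (v t) k := fun t => by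
    by_cases ht : 0 ≤ t
    · obtain ⟨g, hg⟩ := (hv t ht).1; exact ⟨g, fun _ => hg⟩
    · exact ⟨0, fun h => absurd h ht⟩
  choose g hg using hg
  choose k hk using hk
  have hgc := continuousOn_of_continuousInSobolev hu hg
  have hkc := continuousOn_of_continuousInSobolev hv hk
  refine ⟨r, fun t => (g t, k t), ?_, hg, hg 0 le_rfl, hk 0 le_rfl⟩
  refine IsEvolution.of_weak (a := fun φ : Test n => besselTest (-(r - 2) / 2) φ)
    (fun x hx => eq_zero_of_inner_besselTest _ x hx) hgc hkc (fun t ht => ?_) (fun φ t ht => ?_)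
  · have hgS : ∀ τ, 0 ≤ τ → IsBesselDeriv (r - 1) (u τ)
        (Heisenberg.opPow (subLaplacianResolvent n) (1 / 2) (g τ)) := fun τ hτ =>
      (hg τ hτ).opPow (by norm_num) (by ring)
    have hnhds : 𝓝[≠] t = 𝓝[Ici 0 \ {t}] t := by
      rw [sdiff_eq, nhdsWithin_inter_of_mem (mem_nhdsWithin_of_mem_nhds (Ici_mem_nhds ht))]
    rw [hnhds]
    refine (huv t ht.le).congr' ?_
    filter_upwards [self_mem_nhdsWithin] with τ hτ
    rw [((((hgS τ hτ.1).sub (hgS t ht.le)).smul _).sub (hk t ht.le)).sobolevNorm_eq]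
  · have hkS : ∀ τ, 0 ≤ τ → v τ φ = inner ℂ (besselTest (-(r - 2) / 2) φ)
        (Heisenberg.opPow (subLaplacianResolvent n) (1 / 2) (k τ)) :=
      fun τ hτ => (hk τ hτ).opPow (by norm_num) (by ring) φ
    have hgR : u t φ = inner ℂ (besselTest (-(r - 2) / 2) φ) (subLaplacianResolvent n (g t)) := by
      have := (hg t ht.le).opPow (a := 1) (s' := r - 2) (by norm_num) (by ring) φ
      rwa [opPow_one resolvent_isPositive] at this
    have hA : u t (oneSubLap n φ) = inner ℂ (besselTest (-(r - 2) / 2) φ) (g t) := by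
      rw [hg t ht.le, besselTest_oneSubLap]
      congr 2
      ring
    have hL : u t (subLaplacian φ) = u t φ - u t (oneSubLap n φ) := by
      rw [← map_sub, oneSubLap_apply, sub_sub_cancel]
    refine ((heq φ t ht).congr_deriv ?_).congr_of_eventuallyEq ?_
    · rw [hL, hA, hgR, hkS t ht.le, inner_sub_right, inner_add_right, inner_neg_right,
        inner_smul_right, inner_smul_right]
      push_cast; ring
    · filter_upwards [lt_mem_nhds ht] with τ hτ using (hkS τ hτ.le).symm

/-- The coefficients of a chain of derivatives on `(0, ∞)` are the iterated derivatives. -/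
theorem contDiffOn_of_chain {c : ℕ → ℝ → ℂ}
    (h : ∀ i t, 0 < t → HasDerivAt (c i) (c (i + 1) t) t) (k i : ℕ) :
    ContDiffOn ℝ k (c i) (Ioi 0) ∧ ∀ t, 0 < t → iteratedDeriv k (c i) t = c (i + k) t := by
  induction k generalizing i with
  | zero =>
    refine ⟨?_, fun t _ => by simp⟩
    rw [Nat.cast_zero, contDiffOn_zero]
    exact fun t ht => (h i t ht).continuousAt.continuousWithinAt
  | succ k ih =>
    have hd : ∀ t ∈ Ioi (0 : ℝ), deriv (c i) t = c (i + 1) t := fun t ht => (h i t ht).deriv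
    refine ⟨?_, fun t ht => ?_⟩
    · rw [Nat.cast_succ, contDiffOn_succ_iff_deriv_of_isOpen isOpen_Ioi]
      refine ⟨fun t ht => (h i t ht).differentiableAt.differentiableWithinAt, by simp, ?_⟩
      exact (ih (i + 1)).1.congr hd
    · rw [iteratedDeriv_succ', Set.EqOn.iteratedDeriv_of_isOpen hd isOpen_Ioi k ht,
        (ih (i + 1)).2 t ht]
      congr 1
      omega

/-! ### Decay of the time derivatives -/

theorem opPow_commute {H : Type*} [NormedAddCommGroup H] [InnerProductSpace ℂ H] [CompleteSpace H]
    (R : H →L[ℂ] H) (a c : ℝ) : Commute (opPow R a) (opPow R c) := cfc_commute_cfc _ _ _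

theorem opPow_commute_self {H : Type*} [NormedAddCommGroup H] [InnerProductSpace ℂ H]
    [CompleteSpace H] {R : H →L[ℂ] H} (hR : R.IsPositive) (a : ℝ) : Commute (opPow R a) R := by
  have := opPow_commute R a 1
  rwa [opPow_one hR] at this

/-- A solution with data in `H^l × H^(l-1)` is represented at a low order `l - 2 N + 1` by an
evolution `V`, and in `H^l × H^(l-1)` by a decaying function `W`. -/
theorem IsSolution.exists_representation {b m : ℝ} (hb : 0 < b) (hm : 0 < m) {u₀ u₁ : Distr n}
    {u : ℝ → Distr n} (h : IsSolution b m u₀ u₁ u) {l : ℝ} {G K : L2 n}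
    (hG : IsBesselDeriv l u₀ G) (hK : IsBesselDeriv (l - 1) u₁ K) :
    ∃ (N : ℕ) (V W : ℝ → L2 n × L2 n), IsEvolution (subLaplacianResolvent n) b m V ∧
      (∀ t, 0 ≤ t → IsBesselDeriv (l - 2 * N + 1) (u t) (V t).1) ∧
      ∀ t, 0 ≤ t → diag (opPow (subLaplacianResolvent n) (1 / 2)) (V t)
          = diag (subLaplacianResolvent n ^ N) (W t) ∧
        ‖(W t).1‖ ^ 2 + ‖(W t).2‖ ^ 2 ≤ decayConst b m * Real.exp (-2 * decayRate b m * t) *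
          (‖G‖ ^ 2 + ‖K‖ ^ 2) := by
  obtain ⟨r, V, hV, hu, hu₀, hu₁⟩ := h.exists_isEvolution
  have hpos := resolvent_isPositive (n := n)
  set N : ℕ := ⌈(l + 1 - r) / 2⌉₊ with hN
  have hNr : (l + 1 - r) / 2 ≤ N := Nat.le_ceil _
  -- pass to a lower order, at which the data lie in the range of a power of the resolvent
  set a : ℝ := (r - (l - 2 * N + 1)) / 2 with ha
  have ha0 : 0 ≤ a := by rw [ha]; linarith
  have hV' := hV.diag (opPow_commute_self hpos a) (opPow_commute _ a (1 / 2))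
  have hlow : ∀ t, 0 ≤ t → IsBesselDeriv (l - 2 * N + 1) (u t)
      (diag (opPow (subLaplacianResolvent n) a) (V t)).1 := fun t ht =>
    (hu t ht).opPow ha0 (by rw [ha]; ring)
  have h0 : diag (opPow (subLaplacianResolvent n) (1 / 2))
      (diag (opPow (subLaplacianResolvent n) a) (V 0))
      = diag (subLaplacianResolvent n ^ N) (G, K) := by
    rw [← opPow_natCast hpos]
    refine Prod.ext ?_ ?_
    · refine IsBesselDeriv.unique (s := l - 2 * N) (f := u₀)
        ((hu₀.opPow (s' := l - 2 * N + 1) ha0 (by rw [ha]; ring)).opPow (by norm_num) (by ring))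
        (hG.opPow N.cast_nonneg rfl)
    · refine IsBesselDeriv.unique (s := l - 1 - 2 * N) (f := u₁)
        ((hu₁.opPow (s' := l - 2 * N) ha0 (by rw [ha]; ring)).opPow (by norm_num) (by ring))
        (hK.opPow N.cast_nonneg rfl)
  have hex : ∀ t, ∃ W : L2 n × L2 n, 0 ≤ t →
      diag (opPow (subLaplacianResolvent n) (1 / 2))
          (diag (opPow (subLaplacianResolvent n) a) (V t))
          = diag (subLaplacianResolvent n ^ N) W ∧
        ‖W.1‖ ^ 2 + ‖W.2‖ ^ 2 ≤ decayConst b m * Real.exp (-2 * decayRate b m * t) *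
          (‖G‖ ^ 2 + ‖K‖ ^ 2) := fun t => by
    by_cases ht : 0 ≤ t
    · obtain ⟨W, hW⟩ := hV'.exists_preimage hpos norm_resolvent_le resolvent_injective hb hm N h0 ht
      exact ⟨W, fun _ => hW⟩
    · exact ⟨0, fun h => absurd h ht⟩
  choose W hW using hex
  exact ⟨N, _, W, hV', hlow, hW⟩

/-- The pairing of a test function with the representative of the `i`-th time derivative. -/
def derivCoeff (b m l : ℝ) (N : ℕ) (V : ℝ → L2 n × L2 n) (φ : Test n) (i : ℕ) (t : ℝ) : ℂ :=
  inner ℂ (besselTest (-(l - 2 * N - i) / 2) φ)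
    (opPow (subLaplacianResolvent n) (1 / 2) ((waveGen (subLaplacianResolvent n) b m ^ i) (V t)).1)

theorem derivCoeff_eq (b m l : ℝ) (N : ℕ) (V : ℝ → L2 n × L2 n) (φ : Test n) (i : ℕ) (t : ℝ) :
    derivCoeff b m l N V φ i t = inner ℂ (besselTest (-(l - 2 * N + 1 - i) / 2) φ)
      ((waveGen (subLaplacianResolvent n) b m ^ i) (V t)).1 := by
  rw [derivCoeff, ← opPow_inner, opPow_besselTest (by norm_num)]
  congr 2
  ring

theorem hasDerivAt_derivCoeff {b m : ℝ} (l : ℝ) (N : ℕ) {V : ℝ → L2 n × L2 n}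
    (hV : IsEvolution (subLaplacianResolvent n) b m V) (φ : Test n) (i : ℕ) {t : ℝ} (ht : 0 < t) :
    HasDerivAt (derivCoeff b m l N V φ i) (derivCoeff b m l N V φ (i + 1) t) t := by
  have h1 := ((innerSL ℂ (besselTest (-(l - 2 * N - i) / 2) φ)) ∘L
    (ContinuousLinearMap.fst ℂ (L2 n) (L2 n))).hasDerivAt_comp_real
    (hV.hasDerivAt_waveGen_pow resolvent_isPositive i ht)
  have h2 : derivCoeff b m l N V φ (i + 1) t = inner ℂ (besselTest (-(l - 2 * N - i) / 2) φ)
      ((waveGen (subLaplacianResolvent n) b m ^ (i + 1)) (V t)).1 := by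
    rw [derivCoeff_eq]
    congr 2
    push_cast; ring
  rw [h2]
  exact h1

theorem derivCoeff_eq_besselDistr {b m s l : ℝ} {N : ℕ} {V : ℝ → L2 n × L2 n} {W : L2 n × L2 n}
    (α : ℕ) (hl : l = α + s) {t : ℝ}
    (h : diag (opPow (subLaplacianResolvent n) (1 / 2)) (V t)
      = diag (subLaplacianResolvent n ^ N) W) (φ : Test n) :
    derivCoeff b m l N V φ α t
      = besselDistr (-s / 2) ((waveGen (subLaplacianResolvent n) b m ^ α) W).1 φ := by
  have hpos := resolvent_isPositive (n := n)
  have h1 : opPow (subLaplacianResolvent n) (1 / 2)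
      ((waveGen (subLaplacianResolvent n) b m ^ α) (V t)).1
      = (subLaplacianResolvent n ^ N) ((waveGen (subLaplacianResolvent n) b m ^ α) W).1 := by
    have h2 := waveGen_pow_diag (b := b) (m := m) (opPow_commute_self hpos (1 / 2))
      (opPow_commute _ (1 / 2) (1 / 2)) α (V t)
    have h3 := waveGen_pow_diag (b := b) (m := m) (opPow_commute_self hpos N)
      (opPow_commute _ N (1 / 2)) α W
    rw [opPow_natCast hpos] at h3
    rw [h, h3] at h2
    exact (congrArg Prod.fst h2).symm
  rw [derivCoeff, h1, besselDistr_apply, ← opPow_natCast hpos, ← opPow_inner,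
    opPow_besselTest N.cast_nonneg]
  congr 2
  rw [hl]; ring

theorem enorm_sq_eq_ofReal {E : Type*} [SeminormedAddCommGroup E] (x : E) :
    ‖x‖ₑ ^ 2 = ENNReal.ofReal (‖x‖ ^ 2) := by
  rw [← ofReal_norm, ENNReal.ofReal_pow (norm_nonneg _)]

/-- The decay constant for the time derivative of order `α`. -/
def derivConst (n : ℕ) (b m : ℝ) (α : ℕ) : ℝ :=
  (‖waveGen (subLaplacianResolvent n) b m ^ α‖ ^ 2 + 1) * decayConst b m

theorem derivConst_pos (n : ℕ) {b m : ℝ} (hm : 0 < m) (α : ℕ) : 0 < derivConst n b m α :=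
  mul_pos (by positivity) (decayConst_pos hm)

theorem IsSolution.exists_timeDeriv {b m : ℝ} (hb : 0 < b) (hm : 0 < m) (s : ℝ) (α : ℕ)
    {u₀ u₁ : Distr n} {u : ℝ → Distr n} (hu₀ : MemSobolev (α + s) u₀)
    (hu₁ : MemSobolev (α + s - 1) u₁) (h : IsSolution b m u₀ u₁ u) :
    ∃ w : ℝ → Distr n, IsTimeDeriv α u w ∧ ∀ t : ℝ, 0 < t →
      MemSobolev s (w t) ∧
      sobolevNorm s (w t) ^ 2 ≤
        ENNReal.ofReal (derivConst n b m α * Real.exp (-2 * decayRate b m * t)) *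
          (sobolevNorm (α + s) u₀ ^ 2 + sobolevNorm (α + s - 1) u₁ ^ 2) := by
  obtain ⟨G, hG⟩ := hu₀
  obtain ⟨K, hK⟩ := hu₁
  obtain ⟨N, V, W, hV, hu, hW⟩ := h.exists_representation hb hm hG hK
  set M := waveGen (subLaplacianResolvent n) b m ^ α with hM
  refine ⟨fun t => besselDistr (-s / 2) (M (W t)).1, fun φ => ?_, fun t ht => ?_⟩
  · have hchain := contDiffOn_of_chain (c := derivCoeff b m (α + s) N V φ)
      (fun i t ht => hasDerivAt_derivCoeff (α + s) N hV φ i ht) α 0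
    have heq : EqOn (fun t => u t φ) (derivCoeff b m (α + s) N V φ 0) (Ioi 0) := fun t ht => by
      have h1 := derivCoeff_eq b m (α + s) N V φ 0 t
      rw [h1, pow_zero]
      have h2 := hu t (le_of_lt ht) φ
      simp only [Nat.cast_zero, sub_zero]
      exact h2
    refine ⟨hchain.1.congr heq, fun t ht => ?_⟩
    rw [heq.iteratedDeriv_of_isOpen isOpen_Ioi α ht, hchain.2 t ht, zero_add]
    exact (derivCoeff_eq_besselDistr α rfl (hW t ht.le).1 φ).symm
  · have hrep := isBesselDeriv_besselDistr s (M (W t)).1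
    refine ⟨⟨_, hrep⟩, ?_⟩
    rw [hrep.sobolevNorm_eq, hG.sobolevNorm_eq, hK.sobolevNorm_eq, enorm_sq_eq_ofReal,
      enorm_sq_eq_ofReal, enorm_sq_eq_ofReal, ← ENNReal.ofReal_add (sq_nonneg _) (sq_nonneg _),
      ← ENNReal.ofReal_mul (mul_pos (derivConst_pos n hm α) (Real.exp_pos _)).le]
    refine ENNReal.ofReal_le_ofReal ?_
    have h1 : ‖(M (W t)).1‖ ≤ ‖M‖ * ‖W t‖ := (norm_fst_le _).trans (M.le_opNorm _)
    have h2 : ‖W t‖ ^ 2 ≤ ‖(W t).1‖ ^ 2 + ‖(W t).2‖ ^ 2 := by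
      rcases max_choice ‖(W t).1‖ ‖(W t).2‖ with h | h
      · rw [Prod.norm_def, h]; exact le_add_of_nonneg_right (sq_nonneg _)
      · rw [Prod.norm_def, h]; exact le_add_of_nonneg_left (sq_nonneg _)
    calc ‖(M (W t)).1‖ ^ 2 ≤ (‖M‖ * ‖W t‖) ^ 2 := by gcongr
      _ = ‖M‖ ^ 2 * ‖W t‖ ^ 2 := mul_pow _ _ _
      _ ≤ (‖M‖ ^ 2 + 1) * (‖(W t).1‖ ^ 2 + ‖(W t).2‖ ^ 2) := by
          gcongr
          linarith
      _ ≤ (‖M‖ ^ 2 + 1) * (decayConst b m * Real.exp (-2 * decayRate b m * t) *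
          (‖G‖ ^ 2 + ‖K‖ ^ 2)) := by
          gcongr
          exact (hW t ht.le).2
      _ = _ := by rw [derivConst, ← hM]; ring

end

end Heisenberg

end

theorem proposition2p1 (n : ℕ) (hn : 1 ≤ n) (b m : ℝ) (hb : 0 < b) (hm : 0 < m) :
    ∃ δ : ℝ, 0 < δ ∧ ∀ s : ℝ,
      (∃ C : ℝ, 0 < C ∧ ∀ (u₀ u₁ : Heisenberg.Distr n) (u : ℝ → Heisenberg.Distr n),
        Heisenberg.MemSobolev s u₀ → Heisenberg.MemSobolev (s - 1) u₁ →
        Heisenberg.IsSolution b m u₀ u₁ u →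
        ∀ t : ℝ, 0 < t →
          Heisenberg.MemSobolev s (u t) ∧
          Heisenberg.sobolevNorm s (u t) ^ 2 ≤
            ENNReal.ofReal (C * Real.exp (-2 * δ * t)) *
              (Heisenberg.sobolevNorm s u₀ ^ 2 + Heisenberg.sobolevNorm (s - 1) u₁ ^ 2)) ∧
      (∀ α : ℕ, ∃ C : ℝ, 0 < C ∧ ∀ (u₀ u₁ : Heisenberg.Distr n) (u : ℝ → Heisenberg.Distr n),
        Heisenberg.MemSobolev (α + s) u₀ → Heisenberg.MemSobolev (α + s - 1) u₁ →
        Heisenberg.IsSolution b m u₀ u₁ u →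
        ∃ w : ℝ → Heisenberg.Distr n, Heisenberg.IsTimeDeriv α u w ∧
          ∀ t : ℝ, 0 < t →
            Heisenberg.MemSobolev s (w t) ∧
            Heisenberg.sobolevNorm s (w t) ^ 2 ≤
              ENNReal.ofReal (C * Real.exp (-2 * δ * t)) *
                (Heisenberg.sobolevNorm (α + s) u₀ ^ 2 +
                  Heisenberg.sobolevNorm (α + s - 1) u₁ ^ 2)) := by
  refine ⟨Heisenberg.decayRate b m, Heisenberg.decayRate_pos hb hm, fun s => ⟨?_, fun α => ?_⟩⟩
  · refine ⟨Heisenberg.derivConst n b m 0, Heisenberg.derivConst_pos n hm 0, ?_⟩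
    intro u₀ u₁ u hu₀ hu₁ hu t ht
    have hs : ((0 : ℕ) : ℝ) + s = s := by rw [Nat.cast_zero, zero_add]
    obtain ⟨w, hw, hdecay⟩ := hu.exists_timeDeriv hb hm s 0 (by rwa [hs]) (by rwa [hs])
    -- the time derivative of order zero is the solution itself
    have hwu : w t = u t := by
      ext φ
      rw [(hw φ).2 t ht, iteratedDeriv_zero]
    have h := hdecay t ht
    rwa [hs, hwu] at h
  · exact ⟨Heisenberg.derivConst n b m α, Heisenberg.derivConst_pos n hm α,
      fun u₀ u₁ u hu₀ hu₁ hu => hu.exists_timeDeriv hb hm s α hu₀ hu₁⟩
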